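/- **Setting.** For every $x\in\mathbb Z$ let $\mathfrak A_x$ be a unital $C^*$-algebra and $\xi_x:\mathfrak A_x\to\mathbb C^{2\times 2}$ a $*$-isomorphism. For a nonempty finite set $\Lambda\subset\mathbb Z$ let $\mathfrak A_\Lambda=\bigotimes_{x\in\Lambda}\mathfrak A_x$ be the algebraic tensor product, with factorwise multiplication and involution and with its unique $C^*$-norm (the spectral norm, under the identification $\bigotimes_x\xi_x$ with the matrices of size $2^{|\Lambda|}$). Let $\mathfrak A$ be the inductive limit $C^*$-algebra (infinite tensor product) of the $\mathfrak A_\Lambda$ with respect to the unital embeddings $A\mapsto A\otimes 1_{\Lambda'\setminus\Lambda}$, $\Lambda\subseteq\Lambda'$. Let $\sigma_0=1$, let $\sigma_1,\sigma_2,\sigma_3$ be the Pauli matrices, and let $\sigma_\kappa^{(x)}\in\mathfrak A$ be the image of $\xi_x^{-1}(\sigma_\kappa)\in\mathfrak A_x$. Set $\sigma_-^{(x)}=\frac12(\sigma_1^{(x)}-\mathrm i\sigma_2^{(x)})$, and $S_x=\prod_{1\le y\le x-1}\sigma_3^{(y)}$ if $x\ge 1$ (so $S_1=1$), $S_x=\prod_{x\le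 y\le 0}\sigma_3^{(y)}$ if $x\le 0$. With $\varepsilon_0=\varepsilon_3=1$ and $\varepsilon_1=\varepsilon_2=-1$, let $\Theta,\Theta'$ be the $*$-automorphisms of $\mathfrak A$ with $\Theta(\sigma_\kappa^{(x)})=\varepsilon_\kappa\sigma_\kappa^{(x)}$ for all $x$, and $\Theta'(\sigma_\kappa^{(x)})=\sigma_\kappa^{(x)}$ for $x\ge 1$, $\Theta'(\sigma_\kappa^{(x)})=\varepsilon_\kappa\sigma_\kappa^{(x)}$ for $x\le 0$. In the $C^*$-algebra $\mathfrak A^{2\times 2}$ of $2\times2$ matrices over $\mathfrak A$ consider the unital $C^*$-subalgebra $$\widehat{\mathfrak A}=\left\{\begin{bmatrix}A&B\\ \Theta'(B)&\Theta'(A)\end{bmatrix}\,\middle|\,A,B\in\mathfrak A\right\},\qquad \psi(A)=\begin{bmatrix}A&0\\0&\Theta'(A)\end{bmatrix}\ (A\in\mathfrak A),\qquad T=\begin{bmatrix}0&1\\1&0\end{bmatrix}\in\widehat{\mathfrak A},$$ the spin subalgebra $\widehat{\mathfrak A}_0=\psi(\mathfrak A)$, the annihilation operators $a_x=T\psi(S_x\sigma_-^{(x)})$,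 and the CAR subalgebra $\widehat{\mathfrak A}_1$, the intersection of all $C^*$-subalgebras of $\widehat{\mathfrak A}$ that contain $a_x$ for all $x\in\mathbb Z$. For $\mathcal C\subseteq\widehat{\mathfrak A}$ put $\mathcal CT=\{AT\mid A\in\mathcal C\}$. **Proposition (Decomposition).** (a) There is a unique $*$-automorphism $\widehat\Theta$ of $\widehat{\mathfrak A}$ with $\widehat\Theta\circ\psi=\psi\circ\Theta$ and $\widehat\Theta(T)=T$. (b) We have $\widehat\Theta(\widehat{\mathfrak A}_0)\subseteq\widehat{\mathfrak A}_0$ and $\widehat\Theta(\widehat{\mathfrak A}_1)\subseteq\widehat{\mathfrak A}_1$. Let $\widehat{\mathfrak A}_\pm=\{A\in\widehat{\mathfrak A}\mid\widehat\Theta(A)=\pm A\}$ and $\widehat{\mathfrak A}_{i,\pm}=\{A\in\widehat{\mathfrak A}_i\mid\widehat\Theta(A)=\pm A\}$ for $i\in\{0,1\}$. The even parts $\widehat{\mathfrak A}_+$, $\widehat{\mathfrak A}_{0,+}$, $\widehat{\mathfrak A}_{1,+}$ are unital $C^*$-subalgebras of $\widehat{\mathfrak A}$. The odd parts $\widehat{\mathfrak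 A}_-$, $\widehat{\mathfrak A}_{0,-}$, $\widehat{\mathfrak A}_{1,-}$ are norm closed vector subspaces of $\widehat{\mathfrak A}$ that are invariant under the involution. (c) As internal direct sums of vector subspaces, $\widehat{\mathfrak A}=\widehat{\mathfrak A}_+\oplus\widehat{\mathfrak A}_-$, $\widehat{\mathfrak A}_0=\widehat{\mathfrak A}_{0,+}\oplus\widehat{\mathfrak A}_{0,-}$, and $\widehat{\mathfrak A}_1=\widehat{\mathfrak A}_{1,+}\oplus\widehat{\mathfrak A}_{1,-}$. The even and odd parts are related by $$\widehat{\mathfrak A}_{1,+}=\widehat{\mathfrak A}_{0,+},\qquad \widehat{\mathfrak A}_{1,-}=\widehat{\mathfrak A}_{0,-}T,$$ and moreover $\widehat{\mathfrak A}=\widehat{\mathfrak A}_1\oplus\widehat{\mathfrak A}_1T$. -/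

import Mathlib

noncomputable section

namespace ArakiJW

open scoped TensorProduct Matrix.Norms.L2Operator

universe u

/-- The complex `2 × 2` matrices. -/
abbrev M2 : Type := Matrix (Fin 2) (Fin 2) ℂ

/-- The nonempty finite subsets of the configuration space `ℤ`, directed by inclusion. -/
abbrev FinZ : Type := {Λ : Finset ℤ // Λ.Nonempty}

instance : IsDirectedOrder FinZ :=
  ⟨fun Λ Γ => ⟨⟨Λ.1 ∪ Γ.1, Λ.2.mono Finset.subset_union_left⟩,
    Finset.subset_union_left, Finset.subset_union_right⟩⟩

instance : Nonempty FinZ := ⟨⟨{0}, Finset.singleton_nonempty 0⟩⟩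

variable {𝔄 : ℤ → Type u} [∀ x, CStarAlgebra (𝔄 x)] (ξ : ∀ x, 𝔄 x ≃⋆ₐ[ℂ] M2)

/-! ### Local observable algebras -/

/-- The local observable algebra over `Λ`: the algebraic tensor product of the one-site algebras
`𝔄 x`, `x ∈ Λ`, with its factorwise multiplication. Its involution and its `C*`-norm are
introduced below. -/
def LocalAlg (_ξ : ∀ x, 𝔄 x ≃⋆ₐ[ℂ] M2) (Λ : FinZ) : Type u := ⨂[ℂ] x : Λ.1, 𝔄 x

variable (Λ : FinZ)

instance : Ring (LocalAlg ξ Λ) := inferInstanceAs (Ring (⨂[ℂ] x : Λ.1, 𝔄 x))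

instance : Algebra ℂ (LocalAlg ξ Λ) := inferInstanceAs (Algebra ℂ (⨂[ℂ] x : Λ.1, 𝔄 x))

/-- The elementary tensor `⊗_{x ∈ Λ} A x`. -/
def LocalAlg.pure (A : ∀ x : Λ.1, 𝔄 x) : LocalAlg ξ Λ := PiTensorProduct.tprod ℂ A

/-- The matrices of size `2 ^ |Λ|`, with rows and columns indexed by spin configurations. -/
abbrev LocalMat : Type := Matrix (Λ.1 → Fin 2) (Λ.1 → Fin 2) ℂ

/-- The matrix entry `(i, j)` of the Kronecker product of the `ξ x (A x)`. -/
def kronEntry (i j : Λ.1 → Fin 2) : MultilinearMap ℂ (fun x : Λ.1 => 𝔄 x) ℂ :=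
  (MultilinearMap.mkPiAlgebra ℂ Λ.1 ℂ).compLinearMap fun x : Λ.1 =>
    (Matrix.entryLinearMap ℂ ℂ (i x) (j x)).comp (ξ x).toAlgEquiv.toLinearEquiv.toLinearMap

lemma kronEntry_apply (i j : Λ.1 → Fin 2) (A : ∀ x : Λ.1, 𝔄 x) :
    kronEntry ξ Λ i j A = ∏ x : Λ.1, ξ x (A x) (i x) (j x) := by
  simp [kronEntry]

/-- The Kronecker product of the matrices `ξ x (A x)`, `x ∈ Λ`. -/
def kron : MultilinearMap ℂ (fun x : Λ.1 => 𝔄 x) (LocalMat Λ) where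
  toFun A := Matrix.of fun i j => ∏ x : Λ.1, ξ x (A x) (i x) (j x)
  map_update_add' := by
    intro _ A x a b
    ext i j
    have h := (kronEntry ξ Λ i j).map_update_add A x a b
    simp only [kronEntry_apply] at h
    exact h
  map_update_smul' := by
    intro _ A x c a
    ext i j
    have h := (kronEntry ξ Λ i j).map_update_smul A x c a
    simp only [kronEntry_apply] at h
    exact h

lemma kron_apply (A : ∀ x : Λ.1, 𝔄 x) (i j : Λ.1 → Fin 2) :
    kron ξ Λ A i j = ∏ x : Λ.1, ξ x (A x) (i x) (j x) := rfl

/-- The algebra homomorphism given by the Kronecker product on elementary tensors. -/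
def xiHom : LocalAlg ξ Λ →ₐ[ℂ] LocalMat Λ :=
  PiTensorProduct.liftAlgHom (kron ξ Λ)
    (by
      ext i j
      simp only [kron_apply, Pi.one_apply, map_one, Matrix.one_apply, Fintype.prod_ite_zero,
        Finset.prod_const_one, funext_iff])
    (by
      intro A B
      ext i j
      simp only [kron_apply, Pi.mul_apply, map_mul, Matrix.mul_apply, Finset.prod_univ_sum,
        Fintype.piFinset_univ, Finset.prod_mul_distrib])

lemma xiHom_pure (A : ∀ x : Λ.1, 𝔄 x) : xiHom ξ Λ (LocalAlg.pure ξ Λ A) = kron ξ Λ A :=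
  PiTensorProduct.lift.tprod _

variable {ξ Λ} in
lemma LocalAlg.induction {P : LocalAlg ξ Λ → Prop}
    (smul : ∀ (c : ℂ) A, P (c • LocalAlg.pure ξ Λ A)) (add : ∀ A B, P A → P B → P (A + B))
    (A : LocalAlg ξ Λ) : P A :=
  PiTensorProduct.induction_on (motive := P) A smul add

/-- The basis of `𝔄 x` of matrix units. -/
def siteBasis (x : ℤ) : Module.Basis (Fin 2 × Fin 2) ℂ (𝔄 x) :=
  (Matrix.stdBasis ℂ (Fin 2) (Fin 2)).map (ξ x).symm.toAlgEquiv.toLinearEquiv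

lemma siteBasis_repr (x : ℤ) (a : 𝔄 x) (p : Fin 2 × Fin 2) :
    (siteBasis ξ x).repr a p = ξ x a p.1 p.2 := by
  simp [siteBasis, Matrix.stdBasis]

/-- The basis of the local algebra of tensor products of matrix units. -/
def localBasis : Module.Basis (Λ.1 → Fin 2 × Fin 2) ℂ (LocalAlg ξ Λ) :=
  Basis.piTensorProduct fun x : Λ.1 => siteBasis ξ x

lemma xiHom_entry (A : LocalAlg ξ Λ) (i j : Λ.1 → Fin 2) :
    xiHom ξ Λ A i j = (localBasis ξ Λ).repr A fun x => (i x, j x) := by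
  induction A using LocalAlg.induction with
  | smul c A =>
    have h : (localBasis ξ Λ).repr (LocalAlg.pure ξ Λ A) (fun x => (i x, j x))
        = ∏ x : Λ.1, ξ x (A x) (i x) (j x) := by
      refine (Basis.piTensorProduct_repr_tprod_apply _ _ _).trans ?_
      simp only [siteBasis_repr]
    rw [map_smul, map_smul, xiHom_pure, Finsupp.smul_apply, h, Matrix.smul_apply, kron_apply]
  | add A B hA hB => rw [map_add, map_add, Matrix.add_apply, hA, hB, Finsupp.add_apply]

lemma xiHom_bijective : Function.Bijective (xiHom ξ Λ) := by
  constructor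
  · intro A B h
    apply (localBasis ξ Λ).repr.injective
    ext p
    have := congrFun (congrFun h fun x => (p x).1) fun x => (p x).2
    rwa [xiHom_entry, xiHom_entry] at this
  · intro M
    refine ⟨(localBasis ξ Λ).repr.symm (Finsupp.equivFunOnFinite.symm fun p =>
      M (fun x => (p x).1) fun x => (p x).2), ?_⟩
    ext i j
    rw [xiHom_entry, LinearEquiv.apply_symm_apply]
    rfl

/-- The isomorphism `ξ_Λ` of the local algebra with the matrices of size `2 ^ |Λ|`, given by
the Kronecker product on elementary tensors. -/
def xiLoc : LocalAlg ξ Λ ≃ₐ[ℂ] LocalMat Λ := AlgEquiv.ofBijective (xiHom ξ Λ) (xiHom_bijective ξ Λ)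

lemma xiLoc_pure (A : ∀ x : Λ.1, 𝔄 x) : xiLoc ξ Λ (LocalAlg.pure ξ Λ A) = kron ξ Λ A :=
  xiHom_pure ξ Λ A

/-- The involution; it is characterized on elementary tensors by `LocalAlg.star_pure`. -/
instance : StarRing (LocalAlg ξ Λ) where
  star A := (xiLoc ξ Λ).symm (star (xiLoc ξ Λ A))
  star_involutive A := by simp
  star_mul A B := by simp
  star_add A B := by simp

lemma xiLoc_star (A : LocalAlg ξ Λ) : xiLoc ξ Λ (star A) = star (xiLoc ξ Λ A) :=
  (xiLoc ξ Λ).apply_symm_apply _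

instance : StarModule ℂ (LocalAlg ξ Λ) where
  star_smul c A := (xiLoc ξ Λ).injective (by simp [xiLoc_star])

lemma LocalAlg.star_pure (A : ∀ x : Λ.1, 𝔄 x) :
    star (LocalAlg.pure ξ Λ A) = LocalAlg.pure ξ Λ fun x => star (A x) := by
  apply (xiLoc ξ Λ).injective
  rw [xiLoc_star, xiLoc_pure, xiLoc_pure]
  ext i j
  simp only [kron_apply, Matrix.star_apply, map_star, star_prod]

lemma LocalAlg.pure_mul (A B : ∀ x : Λ.1, 𝔄 x) :
    LocalAlg.pure ξ Λ A * LocalAlg.pure ξ Λ B = LocalAlg.pure ξ Λ (A * B) :=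
  PiTensorProduct.tprod_mul_tprod A B

lemma LocalAlg.pure_one : LocalAlg.pure ξ Λ 1 = 1 := rfl

/-- The norm of `A` is the spectral norm of the matrix `ξ_Λ A`. -/
instance : NormedRing (LocalAlg ξ Λ) :=
  NormedRing.induced (LocalAlg ξ Λ) (LocalMat Λ) (xiLoc ξ Λ) (xiLoc ξ Λ).injective

lemma LocalAlg.norm_def (A : LocalAlg ξ Λ) : ‖A‖ = ‖xiLoc ξ Λ A‖ := rfl

instance : NormedAlgebra ℂ (LocalAlg ξ Λ) where
  norm_smul_le c A := by
    rw [LocalAlg.norm_def, LocalAlg.norm_def, map_smul]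
    exact norm_smul_le c _

instance : CStarRing (LocalAlg ξ Λ) where
  norm_mul_self_le A := by
    rw [LocalAlg.norm_def, LocalAlg.norm_def, map_mul, xiLoc_star]
    exact CStarRing.norm_mul_self_le _

instance : FiniteDimensional ℂ (LocalAlg ξ Λ) := (localBasis ξ Λ).finiteDimensional_of_finite

instance : CStarAlgebra (LocalAlg ξ Λ) where
  toCompleteSpace := FiniteDimensional.complete ℂ _

instance : IsSimpleRing (LocalAlg ξ Λ) :=
  IsSimpleRing.of_ringEquiv (xiLoc ξ Λ).symm.toRingEquiv (IsSimpleRing.matrix _ _)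

lemma norm_localHom {Γ : FinZ} (φ : LocalAlg ξ Λ →⋆ₐ[ℂ] LocalAlg ξ Γ) (A : LocalAlg ξ Λ) :
    ‖φ A‖ = ‖A‖ :=
  NonUnitalStarAlgHom.norm_map φ (RingHom.injective (φ : LocalAlg ξ Λ →+* LocalAlg ξ Γ)) A

/-! ### Isotonies and the infinite tensor product -/

variable {Λ} {Γ : FinZ}

/-- The family on `Γ` which extends `A` by the identity outside of `Λ`. -/
def extendOne (Γ : FinZ) (A : ∀ x : Λ.1, 𝔄 x) (y : Γ.1) : 𝔄 y :=
  if h : (y : ℤ) ∈ Λ.1 then A ⟨y, h⟩ else 1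

lemma extendOne_one : extendOne Γ (1 : ∀ x : Λ.1, 𝔄 x) = 1 := by
  ext y
  by_cases h : (y : ℤ) ∈ Λ.1 <;> simp [extendOne, h]

lemma extendOne_mul (A B : ∀ x : Λ.1, 𝔄 x) :
    extendOne Γ (A * B) = extendOne Γ A * extendOne Γ B := by
  ext y
  by_cases h : (y : ℤ) ∈ Λ.1 <;> simp [extendOne, h]

lemma extendOne_star (A : ∀ x : Λ.1, 𝔄 x) :
    extendOne Γ (fun x => star (A x)) = fun y => star (extendOne Γ A y) := by
  ext y
  by_cases h : (y : ℤ) ∈ Λ.1 <;> simp [extendOne, h]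

lemma extendOne_update [DecidableEq Λ.1] (h : Λ ≤ Γ) (A : ∀ x : Λ.1, 𝔄 x) (x : Λ.1) (a : 𝔄 x) :
    extendOne Γ (Function.update A x a)
      = Function.update (extendOne Γ A) (⟨x, h x.2⟩ : Γ.1) a := by
  ext y
  obtain ⟨y, hy⟩ := y
  obtain ⟨x, hx⟩ := x
  by_cases hyx : y = x
  · subst hyx
    simp [extendOne, hx]
  · by_cases hyΛ : y ∈ Λ.1 <;> simp [extendOne, hyΛ, hyx, Function.update]

/-- The multilinear map `A ↦ A ⊗ 1` underlying the isotony. -/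
def isotonyMulti (h : Λ ≤ Γ) : MultilinearMap ℂ (fun x : Λ.1 => 𝔄 x) (LocalAlg ξ Γ) where
  toFun A := LocalAlg.pure ξ Γ (extendOne Γ A)
  map_update_add' := by
    intro _ A x a b
    simp only [extendOne_update h]
    exact (PiTensorProduct.tprod ℂ).map_update_add _ _ _ _
  map_update_smul' := by
    intro _ A x c a
    simp only [extendOne_update h]
    exact (PiTensorProduct.tprod ℂ).map_update_smul _ _ _ _

/-- The isotony as an algebra homomorphism. -/
def isotonyAlgHom (h : Λ ≤ Γ) : LocalAlg ξ Λ →ₐ[ℂ] LocalAlg ξ Γ :=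
  PiTensorProduct.liftAlgHom (isotonyMulti ξ h)
    (by
      change LocalAlg.pure ξ Γ _ = 1
      rw [extendOne_one, LocalAlg.pure_one])
    (fun A B => by
      change LocalAlg.pure ξ Γ _ = LocalAlg.pure ξ Γ _ * LocalAlg.pure ξ Γ _
      rw [extendOne_mul, LocalAlg.pure_mul])

lemma isotonyAlgHom_pure (h : Λ ≤ Γ) (A : ∀ x : Λ.1, 𝔄 x) :
    isotonyAlgHom ξ h (LocalAlg.pure ξ Λ A) = LocalAlg.pure ξ Γ (extendOne Γ A) :=
  PiTensorProduct.lift.tprod _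

/-- The isotony `φ_{Γ,Λ}`, which maps `A` to `A ⊗ 1_{Γ ∖ Λ}`. -/
def isotony (h : Λ ≤ Γ) : LocalAlg ξ Λ →⋆ₐ[ℂ] LocalAlg ξ Γ where
  toAlgHom := isotonyAlgHom ξ h
  map_star' A := by
    change isotonyAlgHom ξ h (star A) = star (isotonyAlgHom ξ h A)
    induction A using LocalAlg.induction with
    | smul c A =>
      rw [star_smul, map_smul, map_smul, star_smul, LocalAlg.star_pure, isotonyAlgHom_pure,
        isotonyAlgHom_pure, LocalAlg.star_pure, extendOne_star]
    | add A B hA hB => rw [star_add, map_add, map_add, star_add, hA, hB]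

lemma isotony_pure (h : Λ ≤ Γ) (A : ∀ x : Λ.1, 𝔄 x) :
    isotony ξ h (LocalAlg.pure ξ Λ A) = LocalAlg.pure ξ Γ (extendOne Γ A) :=
  isotonyAlgHom_pure ξ h A

lemma isotony_refl (A : LocalAlg ξ Λ) : isotony ξ le_rfl A = A := by
  induction A using LocalAlg.induction with
  | smul c A =>
    rw [map_smul, isotony_pure]
    congr 2
    ext x
    simp [extendOne]
  | add A B hA hB => rw [map_add, hA, hB]

lemma isotony_comp {Δ : FinZ} (h : Λ ≤ Γ) (h' : Γ ≤ Δ) (A : LocalAlg ξ Λ) :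
    isotony ξ h' (isotony ξ h A) = isotony ξ (h.trans h') A := by
  induction A using LocalAlg.induction with
  | smul c A =>
    rw [map_smul, map_smul, map_smul, isotony_pure, isotony_pure, isotony_pure]
    congr 2
    ext x
    by_cases hx : (x : ℤ) ∈ Λ.1
    · have hx' : (x : ℤ) ∈ Γ.1 := h hx
      simp [extendOne, hx, hx']
    · simp [extendOne, hx]
  | add A B hA hB => simp only [map_add, hA, hB]

/-- The families `(f_Λ)` which, from some `Λ` on, are given by the isotonies. -/
def coherent : StarSubalgebra ℂ (∀ Λ : FinZ, LocalAlg ξ Λ) where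
  carrier := {f | ∃ Λ, ∀ Γ, ∀ h : Λ ≤ Γ, f Γ = isotony ξ h (f Λ)}
  mul_mem' := by
    rintro f g ⟨Λ, hf⟩ ⟨Γ, hg⟩
    obtain ⟨Δ, h₁, h₂⟩ := exists_ge_ge Λ Γ
    refine ⟨Δ, fun Δ' h => ?_⟩
    rw [Pi.mul_apply, Pi.mul_apply, hf Δ' (h₁.trans h), hg Δ' (h₂.trans h), hf Δ h₁, hg Δ h₂,
      map_mul, isotony_comp, isotony_comp]
  add_mem' := by
    rintro f g ⟨Λ, hf⟩ ⟨Γ, hg⟩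
    obtain ⟨Δ, h₁, h₂⟩ := exists_ge_ge Λ Γ
    refine ⟨Δ, fun Δ' h => ?_⟩
    rw [Pi.add_apply, Pi.add_apply, hf Δ' (h₁.trans h), hg Δ' (h₂.trans h), hf Δ h₁, hg Δ h₂,
      map_add, isotony_comp, isotony_comp]
  algebraMap_mem' c := ⟨Classical.arbitrary FinZ, fun Γ h => by
    rw [Pi.algebraMap_apply, Pi.algebraMap_apply, AlgHomClass.commutes]⟩
  star_mem' := by
    rintro f ⟨Λ, hf⟩
    exact ⟨Λ, fun Γ h => by rw [Pi.star_apply, Pi.star_apply, hf Γ h, map_star]⟩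

/-- The star algebra of the coherent families, to be equipped with the seminorm
`f ↦ lim_Λ ‖f Λ‖`. -/
def PreAlg (ξ : ∀ x, 𝔄 x ≃⋆ₐ[ℂ] M2) : Type u := coherent ξ

instance : Ring (PreAlg ξ) := inferInstanceAs (Ring (coherent ξ))

instance : Algebra ℂ (PreAlg ξ) := inferInstanceAs (Algebra ℂ (coherent ξ))

instance : StarRing (PreAlg ξ) := inferInstanceAs (StarRing (coherent ξ))

instance : StarModule ℂ (PreAlg ξ) := inferInstanceAs (StarModule ℂ (coherent ξ))

variable {ξ}

/-- The component `f_Λ` of a coherent family. -/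
def PreAlg.val (f : PreAlg ξ) (Λ : FinZ) : LocalAlg ξ Λ := f.1 Λ

/-- The seminorm `lim_Λ ‖f Λ‖`. -/
def PreAlg.seminorm (f : PreAlg ξ) : ℝ := Filter.limUnder Filter.atTop fun Λ => ‖f.val Λ‖

lemma PreAlg.eventually_norm (f : PreAlg ξ) :
    ∀ᶠ Λ in Filter.atTop, ‖f.val Λ‖ = f.seminorm := by
  obtain ⟨Λ, hΛ⟩ := f.2
  have h : ∀ Γ, Λ ≤ Γ → ‖f.val Γ‖ = ‖f.val Λ‖ := fun Γ h => by
    rw [PreAlg.val, hΛ Γ h, norm_localHom]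
    rfl
  have ht : Filter.Tendsto (fun Γ => ‖f.val Γ‖) Filter.atTop (nhds ‖f.val Λ‖) :=
    tendsto_const_nhds.congr' ((Filter.eventually_ge_atTop Λ).mono fun Γ hΓ => (h Γ hΓ).symm)
  filter_upwards [Filter.eventually_ge_atTop Λ] with Γ hΓ
  rw [h Γ hΓ, PreAlg.seminorm, ht.limUnder_eq]

variable (ξ) in
/-- The seminorm on the coherent families, bundled. -/
def preSeminorm : AddGroupSeminorm (PreAlg ξ) where
  toFun := PreAlg.seminorm
  map_zero' := by
    obtain ⟨Λ, h⟩ := (PreAlg.eventually_norm (0 : PreAlg ξ)).exists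
    rw [← h]
    exact norm_zero
  add_le' f g := by
    obtain ⟨Λ, ⟨h₁, h₂⟩, h₃⟩ :=
      ((f.eventually_norm.and g.eventually_norm).and (f + g).eventually_norm).exists
    rw [← h₁, ← h₂, ← h₃]
    exact norm_add_le _ _
  neg' f := by
    obtain ⟨Λ, h₁, h₂⟩ := (f.eventually_norm.and (-f).eventually_norm).exists
    rw [← h₁, ← h₂]
    exact norm_neg _

instance : SeminormedRing (PreAlg ξ) where
  __ := (preSeminorm ξ).toSeminormedAddCommGroup
  __ := (inferInstance : Ring (PreAlg ξ))
  norm_mul_le f g := by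
    change (f * g).seminorm ≤ f.seminorm * g.seminorm
    obtain ⟨Λ, ⟨h₁, h₂⟩, h₃⟩ :=
      ((f.eventually_norm.and g.eventually_norm).and (f * g).eventually_norm).exists
    rw [← h₁, ← h₂, ← h₃]
    exact norm_mul_le _ _

lemma PreAlg.norm_def (f : PreAlg ξ) : ‖f‖ = f.seminorm := rfl

lemma PreAlg.norm_eq {f : PreAlg ξ} {c : ℝ} (h : ∀ᶠ Λ in Filter.atTop, ‖f.val Λ‖ = c) :
    ‖f‖ = c := by
  obtain ⟨Λ, h₁, h₂⟩ := (f.eventually_norm.and h).exists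
  rw [PreAlg.norm_def, ← h₁, h₂]

instance : NormedAlgebra ℂ (PreAlg ξ) where
  norm_smul_le c f := by
    refine (PreAlg.norm_eq ?_).le
    filter_upwards [f.eventually_norm] with Λ h
    rw [PreAlg.norm_def, ← h]
    exact norm_smul c _

lemma PreAlg.norm_star (f : PreAlg ξ) : ‖star f‖ = ‖f‖ := by
  refine PreAlg.norm_eq ?_
  filter_upwards [f.eventually_norm] with Λ h
  rw [PreAlg.norm_def, ← h]
  exact _root_.norm_star (f.val Λ)

lemma PreAlg.norm_star_mul_self (f : PreAlg ξ) : ‖star f * f‖ = ‖f‖ * ‖f‖ := by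
  refine PreAlg.norm_eq ?_
  filter_upwards [f.eventually_norm] with Λ h
  rw [PreAlg.norm_def, ← h]
  exact CStarRing.norm_star_mul_self (x := f.val Λ)

/-- The Hausdorff completion of the coherent families with respect to their seminorm. -/
abbrev InfCompl (ξ : ∀ x, 𝔄 x ≃⋆ₐ[ℂ] M2) : Type u := UniformSpace.Completion (PreAlg ξ)

open UniformSpace

lemma isometry_star_pre : Isometry (star : PreAlg ξ → PreAlg ξ) :=
  AddMonoidHomClass.isometry_of_norm (starAddEquiv : PreAlg ξ ≃+ PreAlg ξ) PreAlg.norm_star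

instance : Star (InfCompl ξ) := ⟨Completion.map star⟩

lemma InfCompl.star_coe (f : PreAlg ξ) : star (f : InfCompl ξ) = ((star f : PreAlg ξ) : InfCompl ξ) :=
  Completion.map_coe isometry_star_pre.uniformContinuous f

instance : ContinuousStar (InfCompl ξ) := ⟨Completion.continuous_map⟩

instance : StarRing (InfCompl ξ) where
  star_involutive A := by
    induction A using Completion.induction_on with
    | hp => exact isClosed_eq (continuous_star.comp continuous_star) continuous_id
    | ih f => rw [InfCompl.star_coe, InfCompl.star_coe, star_star]
  star_mul A B := by
    induction A, B using Completion.induction_on₂ with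
    | hp => exact isClosed_eq (by fun_prop) (by fun_prop)
    | ih f g =>
      rw [← Completion.coe_mul, InfCompl.star_coe, InfCompl.star_coe, InfCompl.star_coe, star_mul,
        Completion.coe_mul]
  star_add A B := by
    induction A, B using Completion.induction_on₂ with
    | hp => exact isClosed_eq (by fun_prop) (by fun_prop)
    | ih f g =>
      rw [← Completion.coe_add, InfCompl.star_coe, InfCompl.star_coe, InfCompl.star_coe, star_add,
        Completion.coe_add]

instance : NormedAlgebra ℂ (InfCompl ξ) where
  norm_smul_le := norm_smul_le

instance : StarModule ℂ (InfCompl ξ) where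
  star_smul c A := by
    induction A using Completion.induction_on with
    | hp =>
      have h : ∀ c : ℂ, Continuous fun B : InfCompl ξ => c • B := fun c => continuous_const_smul c
      exact isClosed_eq (continuous_star.comp (h c)) ((h (star c)).comp continuous_star)
    | ih f =>
      rw [← Completion.coe_smul, InfCompl.star_coe, InfCompl.star_coe, star_smul, Completion.coe_smul]

instance : CStarRing (InfCompl ξ) where
  norm_mul_self_le A := by
    induction A using Completion.induction_on with
    | hp => exact isClosed_le (by fun_prop) (by fun_prop)
    | ih f =>
      rw [InfCompl.star_coe, ← Completion.coe_mul, Completion.norm_coe, Completion.norm_coe,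
        PreAlg.norm_star_mul_self]

instance : CStarAlgebra (InfCompl ξ) where

lemma InfCompl.coe_eq {f g : PreAlg ξ} (h : ∀ᶠ Λ in Filter.atTop, f.val Λ = g.val Λ) :
    (f : InfCompl ξ) = g := by
  rw [← sub_eq_zero, ← Completion.coe_sub, ← norm_eq_zero, Completion.norm_coe]
  refine PreAlg.norm_eq ?_
  filter_upwards [h] with Λ h
  change ‖f.val Λ - g.val Λ‖ = 0
  rw [h, sub_self, norm_zero]

/-- The coherent family of the images of `A` under the isotonies. -/
def preEmb (A : LocalAlg ξ Λ) : PreAlg ξ :=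
  ⟨fun Γ => if h : Λ ≤ Γ then isotony ξ h A else 0, Λ, fun Γ h => by
    simp only [h, le_refl, dite_true, isotony_refl]⟩

lemma preEmb_val (A : LocalAlg ξ Λ) (h : Λ ≤ Γ) : (preEmb A).val Γ = isotony ξ h A := by
  simp [PreAlg.val, preEmb, h]

variable (ξ Λ) in
/-- The embedding of the local algebra over `Λ` into the completion. -/
def embCompl : LocalAlg ξ Λ →⋆ₐ[ℂ] InfCompl ξ where
  toFun A := (preEmb A : InfCompl ξ)
  map_one' := InfCompl.coe_eq <| by
    filter_upwards [Filter.eventually_ge_atTop Λ] with Γ h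
    rw [preEmb_val _ h, map_one]
    rfl
  map_mul' A B := by
    rw [← Completion.coe_mul]
    refine InfCompl.coe_eq ?_
    filter_upwards [Filter.eventually_ge_atTop Λ] with Γ h
    change _ = (preEmb A).val Γ * (preEmb B).val Γ
    rw [preEmb_val _ h, preEmb_val _ h, preEmb_val _ h, map_mul]
  map_zero' := InfCompl.coe_eq <| by
    filter_upwards [Filter.eventually_ge_atTop Λ] with Γ h
    rw [preEmb_val _ h, map_zero]
    rfl
  map_add' A B := by
    rw [← Completion.coe_add]
    refine InfCompl.coe_eq ?_
    filter_upwards [Filter.eventually_ge_atTop Λ] with Γ h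
    change _ = (preEmb A).val Γ + (preEmb B).val Γ
    rw [preEmb_val _ h, preEmb_val _ h, preEmb_val _ h, map_add]
  commutes' c := InfCompl.coe_eq <| by
    filter_upwards [Filter.eventually_ge_atTop Λ] with Γ h
    rw [preEmb_val _ h, AlgHomClass.commutes]
    rfl
  map_star' A := by
    rw [InfCompl.star_coe]
    refine InfCompl.coe_eq ?_
    filter_upwards [Filter.eventually_ge_atTop Λ] with Γ h
    change _ = star ((preEmb A).val Γ)
    rw [preEmb_val _ h, preEmb_val _ h, map_star]

section Rotation

variable (θ : ∀ x, 𝔄 x →⋆ₐ[ℂ] 𝔄 x)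

/-- The multilinear map `A ↦ ⊗_{x ∈ Λ} θ x (A x)`. -/
def localEndMulti (ξ : ∀ x, 𝔄 x ≃⋆ₐ[ℂ] M2) (θ : ∀ x, 𝔄 x →⋆ₐ[ℂ] 𝔄 x) (Λ : FinZ) :
    MultilinearMap ℂ (fun x : Λ.1 => 𝔄 x) (LocalAlg ξ Λ) where
  toFun A := LocalAlg.pure ξ Λ fun x => θ x (A x)
  map_update_add' := ((PiTensorProduct.tprod ℂ).compLinearMap
    fun x : Λ.1 => (θ x).toAlgHom.toLinearMap).map_update_add'
  map_update_smul' := ((PiTensorProduct.tprod ℂ).compLinearMap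
    fun x : Λ.1 => (θ x).toAlgHom.toLinearMap).map_update_smul'

/-- The algebra endomorphism of the local algebra which acts by `θ x` on the factor at `x`. -/
def localEndAlg (ξ : ∀ x, 𝔄 x ≃⋆ₐ[ℂ] M2) (θ : ∀ x, 𝔄 x →⋆ₐ[ℂ] 𝔄 x) (Λ : FinZ) :
    LocalAlg ξ Λ →ₐ[ℂ] LocalAlg ξ Λ :=
  PiTensorProduct.liftAlgHom (localEndMulti ξ θ Λ)
    (by
      change LocalAlg.pure ξ Λ (fun x => θ x 1) = 1
      simp only [map_one]
      rfl)
    (fun A B => by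
      change LocalAlg.pure ξ Λ (fun x => θ x (A x * B x))
        = LocalAlg.pure ξ Λ (fun x => θ x (A x)) * LocalAlg.pure ξ Λ (fun x => θ x (B x))
      simp only [map_mul, LocalAlg.pure_mul]
      rfl)

lemma localEndAlg_pure (A : ∀ x : Λ.1, 𝔄 x) :
    localEndAlg ξ θ Λ (LocalAlg.pure ξ Λ A) = LocalAlg.pure ξ Λ fun x => θ x (A x) :=
  PiTensorProduct.lift.tprod _

/-- The star endomorphism of the local algebra which acts by `θ x` on the factor at `x`. -/
def localEnd (ξ : ∀ x, 𝔄 x ≃⋆ₐ[ℂ] M2) (θ : ∀ x, 𝔄 x →⋆ₐ[ℂ] 𝔄 x) (Λ : FinZ) :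
    LocalAlg ξ Λ →⋆ₐ[ℂ] LocalAlg ξ Λ where
  toAlgHom := localEndAlg ξ θ Λ
  map_star' A := by
    change localEndAlg ξ θ Λ (star A) = star (localEndAlg ξ θ Λ A)
    induction A using LocalAlg.induction with
    | smul c A =>
      rw [star_smul, map_smul, map_smul, star_smul, LocalAlg.star_pure, localEndAlg_pure,
        localEndAlg_pure, LocalAlg.star_pure]
      simp only [map_star]
    | add A B hA hB => rw [star_add, map_add, map_add, star_add, hA, hB]

lemma localEnd_pure (A : ∀ x : Λ.1, 𝔄 x) :
    localEnd ξ θ Λ (LocalAlg.pure ξ Λ A) = LocalAlg.pure ξ Λ fun x => θ x (A x) :=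
  localEndAlg_pure θ A

lemma isotony_localEnd (h : Λ ≤ Γ) (A : LocalAlg ξ Λ) :
    isotony ξ h (localEnd ξ θ Λ A) = localEnd ξ θ Γ (isotony ξ h A) := by
  induction A using LocalAlg.induction with
  | smul c A =>
    rw [map_smul, map_smul, map_smul, map_smul, localEnd_pure, isotony_pure, isotony_pure,
      localEnd_pure]
    congr 2
    ext y
    by_cases hy : (y : ℤ) ∈ Λ.1 <;> simp [extendOne, hy]
  | add A B hA hB => simp only [map_add, hA, hB]

/-- The componentwise action on the coherent families. -/
def preEnd (f : PreAlg ξ) : PreAlg ξ :=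
  ⟨fun Λ => localEnd ξ θ Λ (f.val Λ), by
    obtain ⟨Λ, hΛ⟩ := f.2
    refine ⟨Λ, fun Γ h => ?_⟩
    rw [isotony_localEnd]
    exact congrArg _ (hΛ Γ h)⟩

lemma preEnd_val (f : PreAlg ξ) : (preEnd θ f).val Λ = localEnd ξ θ Λ (f.val Λ) := rfl

lemma isometry_preEnd : Isometry (preEnd (ξ := ξ) θ) := by
  refine Isometry.of_dist_eq fun f g => ?_
  rw [dist_eq_norm, dist_eq_norm]
  refine PreAlg.norm_eq ?_
  filter_upwards [(f - g).eventually_norm] with Λ h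
  rw [PreAlg.norm_def, ← h]
  change ‖localEnd ξ θ Λ (f.val Λ) - localEnd ξ θ Λ (g.val Λ)‖ = ‖f.val Λ - g.val Λ‖
  rw [← map_sub, norm_localHom]

/-- The extension to the completion of the family of the `localEnd ξ θ Λ`. -/
def endCompl (ξ : ∀ x, 𝔄 x ≃⋆ₐ[ℂ] M2) (θ : ∀ x, 𝔄 x →⋆ₐ[ℂ] 𝔄 x) (A : InfCompl ξ) : InfCompl ξ :=
  Completion.map (preEnd θ) A

lemma endCompl_coe (f : PreAlg ξ) : endCompl ξ θ (f : InfCompl ξ) = (preEnd θ f : InfCompl ξ) :=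
  Completion.map_coe (isometry_preEnd θ).uniformContinuous f

lemma continuous_endCompl : Continuous (endCompl ξ θ) := Completion.continuous_map

lemma endCompl_emb (A : LocalAlg ξ Λ) : endCompl ξ θ (embCompl ξ Λ A) = embCompl ξ Λ (localEnd ξ θ Λ A) := by
  change endCompl ξ θ (preEmb A : InfCompl ξ) = (preEmb (localEnd ξ θ Λ A) : InfCompl ξ)
  rw [endCompl_coe]
  refine InfCompl.coe_eq ?_
  filter_upwards [Filter.eventually_ge_atTop Λ] with Γ h
  rw [preEnd_val, preEmb_val _ h, preEmb_val _ h, isotony_localEnd]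

lemma endCompl_endCompl {θ : ∀ x, 𝔄 x →⋆ₐ[ℂ] 𝔄 x} (hθ : ∀ x A, θ x (θ x A) = A) (A : InfCompl ξ) :
    endCompl ξ θ (endCompl ξ θ A) = A := by
  induction A using Completion.induction_on with
  | hp => exact isClosed_eq ((continuous_endCompl θ).comp (continuous_endCompl θ)) continuous_id
  | ih f =>
    rw [endCompl_coe, endCompl_coe]
    refine InfCompl.coe_eq (Filter.Eventually.of_forall fun Λ => ?_)
    rw [preEnd_val, preEnd_val]
    generalize f.val Λ = A
    induction A using LocalAlg.induction with
    | smul c A => simp only [map_smul, localEnd_pure, hθ]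
    | add A B hA hB => simp only [map_add, hA, hB]

/-- `endCompl` as a star automorphism, for involutive one-site automorphisms. -/
def autCompl (ξ : ∀ x, 𝔄 x ≃⋆ₐ[ℂ] M2) (θ : ∀ x, 𝔄 x →⋆ₐ[ℂ] 𝔄 x)
    (hθ : ∀ x A, θ x (θ x A) = A) : InfCompl ξ ≃⋆ₐ[ℂ] InfCompl ξ where
  toFun := endCompl ξ θ
  invFun := endCompl ξ θ
  left_inv := endCompl_endCompl hθ
  right_inv := endCompl_endCompl hθ
  map_mul' A B := by
    have hc := continuous_endCompl (ξ := ξ) θ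
    induction A, B using Completion.induction_on₂ with
    | hp => exact isClosed_eq (by fun_prop) (by fun_prop)
    | ih f g =>
      rw [← Completion.coe_mul, endCompl_coe, endCompl_coe, endCompl_coe, ← Completion.coe_mul]
      exact InfCompl.coe_eq (Filter.Eventually.of_forall fun Λ => map_mul _ _ _)
  map_add' A B := by
    have hc := continuous_endCompl (ξ := ξ) θ
    induction A, B using Completion.induction_on₂ with
    | hp => exact isClosed_eq (by fun_prop) (by fun_prop)
    | ih f g =>
      rw [← Completion.coe_add, endCompl_coe, endCompl_coe, endCompl_coe, ← Completion.coe_add]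
      exact InfCompl.coe_eq (Filter.Eventually.of_forall fun Λ => map_add _ _ _)
  map_star' A := by
    have hc := continuous_endCompl (ξ := ξ) θ
    induction A using Completion.induction_on with
    | hp => exact isClosed_eq (hc.comp continuous_star) (continuous_star.comp hc)
    | ih f =>
      rw [InfCompl.star_coe, endCompl_coe, endCompl_coe, InfCompl.star_coe]
      exact InfCompl.coe_eq (Filter.Eventually.of_forall fun Λ => map_star _ _)
  map_smul' c A := by
    have hc := continuous_endCompl (ξ := ξ) θ
    have h : ∀ c : ℂ, Continuous fun B : InfCompl ξ => c • B := fun c => continuous_const_smul c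
    induction A using Completion.induction_on with
    | hp => exact isClosed_eq (hc.comp (h c)) ((h c).comp hc)
    | ih f =>
      rw [← Completion.coe_smul, endCompl_coe, endCompl_coe, ← Completion.coe_smul]
      exact InfCompl.coe_eq (Filter.Eventually.of_forall fun Λ => map_smul (localEnd ξ θ Λ) c (f.val Λ))

end Rotation

/-- The infinite tensor product `𝔄`: the inductive limit of the local algebras along the
isotonies, i.e. the Hausdorff completion of the coherent families. -/
def InfAlg (ξ : ∀ x, 𝔄 x ≃⋆ₐ[ℂ] M2) : Type u := InfCompl ξ

instance : CStarAlgebra (InfAlg ξ) := inferInstanceAs (CStarAlgebra (InfCompl ξ))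

variable (ξ Λ) in
/-- The embedding `φ_Λ` of the local algebra over `Λ` into the infinite tensor product. -/
def emb : LocalAlg ξ Λ →⋆ₐ[ℂ] InfAlg ξ := embCompl ξ Λ

lemma emb_isotony (h : Λ ≤ Γ) (A : LocalAlg ξ Λ) : emb ξ Γ (isotony ξ h A) = emb ξ Λ A := by
  refine InfCompl.coe_eq ?_
  filter_upwards [Filter.eventually_ge_atTop Γ] with Δ hΔ
  rw [preEmb_val _ hΔ, preEmb_val _ (h.trans hΔ), isotony_comp]

lemma norm_emb (A : LocalAlg ξ Λ) : ‖emb ξ Λ A‖ = ‖A‖ := by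
  refine (Completion.norm_coe (preEmb A)).trans (PreAlg.norm_eq ?_)
  filter_upwards [Filter.eventually_ge_atTop Λ] with Γ h
  rw [preEmb_val _ h, norm_localHom]

/-- The union of the embedded local algebras is dense in the infinite tensor product. -/
lemma dense_iUnion_range_emb : Dense (⋃ Λ, Set.range (emb ξ Λ)) := by
  refine (Completion.denseRange_coe (α := PreAlg ξ)).mono ?_
  rintro _ ⟨f, rfl⟩
  obtain ⟨Λ, hΛ⟩ := f.2
  refine Set.mem_iUnion.2 ⟨Λ, f.val Λ, InfCompl.coe_eq ?_⟩
  filter_upwards [Filter.eventually_ge_atTop Λ] with Γ h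
  rw [preEmb_val _ h]
  exact (hΛ Γ h).symm

/-- The star automorphism of the infinite tensor product which acts by the involutive star
automorphism `θ x` on the factor at `x`, for all sites `x`; see `infAut_emb`. -/
def infAut (ξ : ∀ x, 𝔄 x ≃⋆ₐ[ℂ] M2) (θ : ∀ x, 𝔄 x →⋆ₐ[ℂ] 𝔄 x)
    (hθ : ∀ x A, θ x (θ x A) = A) : InfAlg ξ ≃⋆ₐ[ℂ] InfAlg ξ := autCompl ξ θ hθ

lemma infAut_emb {θ : ∀ x, 𝔄 x →⋆ₐ[ℂ] 𝔄 x} (hθ : ∀ x A, θ x (θ x A) = A)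
    (A : LocalAlg ξ Λ) : infAut ξ θ hθ (emb ξ Λ A) = emb ξ Λ (localEnd ξ θ Λ A) :=
  endCompl_emb θ A

lemma infAut_infAut {θ : ∀ x, 𝔄 x →⋆ₐ[ℂ] 𝔄 x} (hθ : ∀ x A, θ x (θ x A) = A)
    (A : InfAlg ξ) : infAut ξ θ hθ (infAut ξ θ hθ A) = A :=
  endCompl_endCompl hθ A

/-! ### Spin observables -/

/-- The Pauli basis of the complex `2 × 2` matrices, with `pauli 0 = 1`. -/
def pauli : Fin 4 → M2 :=
  ![1, !![0, 1; 1, 0], !![0, -Complex.I; Complex.I, 0], !![1, 0; 0, -1]]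

/-- The sign by which the rotation around the 3-axis by the angle `π` acts on `pauli κ`. -/
def pauliSign : Fin 4 → ℂ := ![1, -1, -1, 1]

variable (ξ)

/-- The spin observable `σ_κ^{(x),Λ}` in the local algebra over `Λ`, for `x ∈ Λ`. -/
def spinLoc (Λ : FinZ) (κ : Fin 4) (x : Λ.1) : LocalAlg ξ Λ :=
  LocalAlg.pure ξ Λ (Pi.mulSingle x ((ξ x).symm (pauli κ)))

/-- The one-point subset `{x}`. -/
def site (x : ℤ) : FinZ := ⟨{x}, Finset.singleton_nonempty x⟩

/-- The spin observable `σ_κ^{(x)}` in the infinite tensor product. -/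
def spin (κ : Fin 4) (x : ℤ) : InfAlg ξ :=
  emb ξ (site x) (spinLoc ξ (site x) κ ⟨x, Finset.mem_singleton_self x⟩)

/-- The definition of `σ_κ^{(x)}` does not depend on the choice of `Λ`. -/
lemma spin_eq (κ : Fin 4) (Λ : FinZ) (x : Λ.1) : spin ξ κ x = emb ξ Λ (spinLoc ξ Λ κ x) := by
  have h : site x ≤ Λ := Finset.singleton_subset_iff.2 x.2
  rw [spin, ← emb_isotony h, spinLoc, spinLoc, isotony_pure]
  congr 2
  ext ⟨y, hy⟩
  obtain ⟨x, hx⟩ := x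
  by_cases hyx : y = x
  · subst hyx
    simp only [extendOne, site, Pi.mulSingle_eq_same]
    refine (dif_pos (Finset.mem_singleton_self y)).trans ?_
    exact dif_pos rfl
  · simp [extendOne, site, hyx]

/-- The lowering operator `σ_-^{(x)}`. -/
def lowering (x : ℤ) : InfAlg ξ := (1 / 2 : ℂ) • (spin ξ 1 x - Complex.I • spin ξ 2 x)

/-- The nonlocal multiplicator `S_x`, the product of the `σ_3^{(y)}` over `1 ≤ y ≤ x - 1`
if `x ≥ 1` and over `x ≤ y ≤ 0` if `x ≤ 0`. -/
def multiplicator (x : ℤ) : InfAlg ξ :=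
  if 1 ≤ x then ((Int.range 1 x).map (spin ξ 3)).prod
  else ((Int.range x 1).map (spin ξ 3)).prod

/-! ### Spin rotations -/

lemma pauli_three_mul_self : pauli 3 * pauli 3 = 1 := by
  ext i j
  fin_cases i <;> fin_cases j <;> simp [pauli]

lemma star_pauli_three : star (pauli 3) = pauli 3 := by
  ext i j
  fin_cases i <;> fin_cases j <;> simp [pauli]

/-- The rotation around the 3-axis by the angle `π` at the site `x`, i.e. conjugation
by `pauli 3`. -/
def siteRot (x : ℤ) : 𝔄 x →⋆ₐ[ℂ] 𝔄 x where
  toFun A := (ξ x).symm (pauli 3 * ξ x A * pauli 3)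
  map_one' := by simp [pauli_three_mul_self]
  map_mul' A B := by
    rw [← map_mul, map_mul (ξ x)]
    congr 1
    calc pauli 3 * (ξ x A * ξ x B) * pauli 3
        = pauli 3 * ξ x A * 1 * ξ x B * pauli 3 := by simp only [mul_assoc, one_mul]
      _ = _ := by rw [← pauli_three_mul_self]; simp only [mul_assoc]
  map_zero' := by simp
  map_add' A B := by simp [mul_add, add_mul]
  commutes' c := by simp [Algebra.algebraMap_eq_smul_one, pauli_three_mul_self]
  map_star' A := by
    rw [← map_star, map_star (ξ x), star_mul, star_mul, star_pauli_three, mul_assoc]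

lemma siteRot_siteRot (x : ℤ) (A : 𝔄 x) : siteRot ξ x (siteRot ξ x A) = A := by
  change (ξ x).symm (pauli 3 * ξ x ((ξ x).symm (pauli 3 * ξ x A * pauli 3)) * pauli 3) = A
  rw [StarAlgEquiv.apply_symm_apply]
  have : pauli 3 * (pauli 3 * ξ x A * pauli 3) * pauli 3 = ξ x A := by
    calc _ = (pauli 3 * pauli 3) * ξ x A * (pauli 3 * pauli 3) := by simp only [mul_assoc]
      _ = _ := by rw [pauli_three_mul_self, one_mul, mul_one]
  rw [this, StarAlgEquiv.symm_apply_apply]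

lemma siteRot_pauli (x : ℤ) (κ : Fin 4) :
    siteRot ξ x ((ξ x).symm (pauli κ)) = pauliSign κ • (ξ x).symm (pauli κ) := by
  change (ξ x).symm (pauli 3 * ξ x ((ξ x).symm (pauli κ)) * pauli 3) = _
  rw [StarAlgEquiv.apply_symm_apply, ← map_smul]
  congr 1
  ext i j
  fin_cases κ <;> fin_cases i <;> fin_cases j <;> simp [pauli, pauliSign]

/-- The rotation at `x` if `x ≤ 0`, and the identity if `x ≥ 1`. -/
def siteHalfRot (x : ℤ) : 𝔄 x →⋆ₐ[ℂ] 𝔄 x :=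
  if 1 ≤ x then StarAlgHom.id ℂ (𝔄 x) else siteRot ξ x

lemma siteHalfRot_siteHalfRot (x : ℤ) (A : 𝔄 x) : siteHalfRot ξ x (siteHalfRot ξ x A) = A := by
  unfold siteHalfRot
  split_ifs
  · rfl
  · exact siteRot_siteRot ξ x A

/-- The spin rotation `Θ`: the rotation around the 3-axis by the angle `π` on all sites. -/
def Theta : InfAlg ξ ≃⋆ₐ[ℂ] InfAlg ξ := infAut ξ (siteRot ξ) (siteRot_siteRot ξ)

/-- The spin rotation `Θ'`: the rotation around the 3-axis by the angle `π` on all sites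
`x ≤ 0`, and the identity on all sites `x ≥ 1`. -/
def Theta' : InfAlg ξ ≃⋆ₐ[ℂ] InfAlg ξ := infAut ξ (siteHalfRot ξ) (siteHalfRot_siteHalfRot ξ)

lemma Theta'_Theta' (A : InfAlg ξ) : Theta' ξ (Theta' ξ A) = A :=
  infAut_infAut (siteHalfRot_siteHalfRot ξ) A

lemma infAut_spin {θ : ∀ x, 𝔄 x →⋆ₐ[ℂ] 𝔄 x} (hθ : ∀ x A, θ x (θ x A) = A) (κ : Fin 4) (x : ℤ) (c : ℂ)
    (h : θ x ((ξ x).symm (pauli κ)) = c • (ξ x).symm (pauli κ)) :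
    infAut ξ θ hθ (spin ξ κ x) = c • spin ξ κ x := by
  rw [spin, infAut_emb, ← map_smul, spinLoc, localEnd_pure]
  congr 1
  set x₀ : (site x).1 := ⟨x, Finset.mem_singleton_self x⟩
  have key := (PiTensorProduct.tprod ℂ).map_update_smul (1 : ∀ y : (site x).1, 𝔄 y) x₀ c
    ((ξ x).symm (pauli κ))
  refine Eq.trans ?_ key
  change PiTensorProduct.tprod ℂ _ = _
  congr 1
  ext ⟨y, hy⟩
  obtain rfl : y = x := Finset.mem_singleton.1 hy
  simp [x₀, h]

/-- The action of `Θ` on the spin observables, which determines it. -/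
lemma Theta_spin (κ : Fin 4) (x : ℤ) : Theta ξ (spin ξ κ x) = pauliSign κ • spin ξ κ x :=
  infAut_spin ξ (siteRot_siteRot ξ) κ x _ (siteRot_pauli ξ x κ)

/-- The action of `Θ'` on the spin observables, which determines it. -/
lemma Theta'_spin (κ : Fin 4) (x : ℤ) :
    Theta' ξ (spin ξ κ x) = if 1 ≤ x then spin ξ κ x else pauliSign κ • spin ξ κ x := by
  split_ifs with hx
  · refine (infAut_spin ξ (siteHalfRot_siteHalfRot ξ) κ x 1 ?_).trans (one_smul _ _)
    simp [siteHalfRot, hx]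
  · refine infAut_spin ξ (siteHalfRot_siteHalfRot ξ) κ x _ ?_
    simpa [siteHalfRot, hx] using siteRot_pauli ξ x κ

/-! ### The crossed product extension -/

instance : PartialOrder (InfAlg ξ) := CStarAlgebra.spectralOrder _

instance : StarOrderedRing (InfAlg ξ) := CStarAlgebra.spectralOrderedRing _

/-- The matrix with rows `(A, B)` and `(Θ' B, Θ' A)`. The type `CStarMatrix` carries the norm of
the operators on the Hilbert `C*`-module of pairs. -/
def hatMatrix (A B : InfAlg ξ) : CStarMatrix (Fin 2) (Fin 2) (InfAlg ξ) :=
  CStarMatrix.ofMatrix !![A, B; Theta' ξ B, Theta' ξ A]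

lemma hatMatrix_add (A B C D : InfAlg ξ) :
    hatMatrix ξ A B + hatMatrix ξ C D = hatMatrix ξ (A + C) (B + D) := by
  ext i j
  fin_cases i <;> fin_cases j <;> simp [hatMatrix]

lemma hatMatrix_mul (A B C D : InfAlg ξ) :
    hatMatrix ξ A B * hatMatrix ξ C D
      = hatMatrix ξ (A * C + B * Theta' ξ D) (A * D + B * Theta' ξ C) := by
  ext i j
  fin_cases i <;> fin_cases j <;>
    simp [hatMatrix, CStarMatrix.mul_apply, Fin.sum_univ_two, Theta'_Theta', add_comm]

lemma hatMatrix_star (A B : InfAlg ξ) :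
    star (hatMatrix ξ A B) = hatMatrix ξ (star A) (star (Theta' ξ B)) := by
  ext i j
  fin_cases i <;> fin_cases j <;>
    simp [hatMatrix, CStarMatrix.star_apply, Theta'_Theta', map_star]

lemma hatMatrix_algebraMap (c : ℂ) :
    hatMatrix ξ (algebraMap ℂ _ c) 0 = algebraMap ℂ _ c := by
  ext i j
  fin_cases i <;> fin_cases j <;>
    simp [hatMatrix, CStarMatrix.algebraMap_apply, Algebra.algebraMap_eq_smul_one]

/-- The crossed product extension `𝔄̂` of the infinite tensor product. -/
def Hat : StarSubalgebra ℂ (CStarMatrix (Fin 2) (Fin 2) (InfAlg ξ)) where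
  carrier := {X | ∃ A B, X = hatMatrix ξ A B}
  mul_mem' := by
    rintro _ _ ⟨A, B, rfl⟩ ⟨C, D, rfl⟩
    exact ⟨_, _, hatMatrix_mul ξ A B C D⟩
  add_mem' := by
    rintro _ _ ⟨A, B, rfl⟩ ⟨C, D, rfl⟩
    exact ⟨_, _, hatMatrix_add ξ A B C D⟩
  algebraMap_mem' c := ⟨_, _, (hatMatrix_algebraMap ξ c).symm⟩
  star_mem' := by
    rintro _ ⟨A, B, rfl⟩
    exact ⟨_, _, hatMatrix_star ξ A B⟩

/-- The embedding `ψ` of the infinite tensor product, `ψ A = diag (A, Θ' A)`. -/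
def psi : InfAlg ξ →⋆ₐ[ℂ] Hat ξ where
  toFun A := ⟨hatMatrix ξ A 0, A, 0, rfl⟩
  map_one' := Subtype.ext (by simpa using hatMatrix_algebraMap ξ 1)
  map_mul' A B := Subtype.ext (by simp [hatMatrix_mul])
  map_zero' := Subtype.ext (by simpa using hatMatrix_algebraMap ξ 0)
  map_add' A B := Subtype.ext (by simp [hatMatrix_add])
  commutes' c := Subtype.ext (hatMatrix_algebraMap ξ c)
  map_star' A := Subtype.ext (by simp [hatMatrix_star])

/-- The spin subalgebra `𝔄̂₀` of the matrices `diag (A, Θ' A)`. -/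
def Hat0 : Set (Hat ξ) := Set.range (psi ξ)

/-- The anchor element `T`, the matrix with rows `(0, 1)` and `(1, 0)`. -/
def anchor : Hat ξ := ⟨hatMatrix ξ 0 1, 0, 1, rfl⟩

/-- The annihilation operator `a_x = T ψ(S_x σ_-^{(x)})`. -/
def annihilation (x : ℤ) : Hat ξ := anchor ξ * psi ξ (multiplicator ξ x * lowering ξ x)

/-- The CAR subalgebra `𝔄̂₁`, the intersection of all `C*`-subalgebras of `𝔄̂` (closed star
subalgebras, not assumed to be unital) which contain all annihilation operators. -/
def Hat1 : Set (Hat ξ) :=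
  ⋂ B ∈ {B : NonUnitalStarSubalgebra ℂ (Hat ξ) |
    IsClosed (B : Set (Hat ξ)) ∧ Set.range (annihilation ξ) ⊆ B}, (B : Set (Hat ξ))

/-! ### Even and odd parts -/

variable {ξ}

/-- The even part of `C` with respect to `θ`. -/
def evenPart (θ : Hat ξ ≃⋆ₐ[ℂ] Hat ξ) (C : Set (Hat ξ)) : Set (Hat ξ) := {A ∈ C | θ A = A}

/-- The odd part of `C` with respect to `θ`. -/
def oddPart (θ : Hat ξ ≃⋆ₐ[ℂ] Hat ξ) (C : Set (Hat ξ)) : Set (Hat ξ) := {A ∈ C | θ A = -A}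

/-- The set `C T` of the products `A T`, `A ∈ C`. -/
def mulAnchor (C : Set (Hat ξ)) : Set (Hat ξ) := (fun A => A * anchor ξ) '' C

/-- `C` is a `C*`-subalgebra of `𝔄̂` which contains the identity of `𝔄̂`. -/
def IsUnitalCStarSubalgebra (C : Set (Hat ξ)) : Prop :=
  IsClosed C ∧ ∃ B : StarSubalgebra ℂ (Hat ξ), (B : Set (Hat ξ)) = C

/-- `C` is a norm closed vector subspace of `𝔄̂` which is invariant under the involution. -/
def IsClosedStarSubspace (C : Set (Hat ξ)) : Prop :=
  IsClosed C ∧ (∃ W : Submodule ℂ (Hat ξ), (W : Set (Hat ξ)) = C) ∧ ∀ A ∈ C, star A ∈ C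

/-- `V` and `W` are vector subspaces of `𝔄̂` and `U` is their internal direct sum. -/
def IsDirectSum (U V W : Set (Hat ξ)) : Prop :=
  ∃ V' W' : Submodule ℂ (Hat ξ), (V' : Set (Hat ξ)) = V ∧ (W' : Set (Hat ξ)) = W ∧
    ((V' ⊔ W' : Submodule ℂ (Hat ξ)) : Set (Hat ξ)) = U ∧ Disjoint V' W'

end ArakiJW

end

open ArakiJW

/-!
The algebra `𝔄̂` is the crossed product of `𝔄` by the involution `Θ'`, implemented by `T`. A star
homomorphism out of it is therefore given by a homomorphism on `ψ(𝔄)` and a self-adjoint unitary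
image of `T` which are covariant. This yields `Θ̂` as well as the dual action `γ`, which fixes
`ψ(𝔄)` and maps `T` to `-T`. The spin subalgebra is the fixed point algebra of `γ`, and the CAR
subalgebra is that of `γ Θ̂`. Indeed `γ Θ̂ a_x = a_x`, so the CAR subalgebra is fixed. Conversely
`𝔄̂₁ + 𝔄̂₁ T` is a star algebra which contains all `T a_x = ψ(S_x σ_-)` and is therefore dense, and
averaging over `γ Θ̂` projects it onto `𝔄̂₁`. All decompositions are eigenspace decompositions of
the commuting involutions `Θ̂` and `γ`.
-/

noncomputable section

namespace ArakiJW

universe u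

/-! ### Involutive linear maps -/

section Involution

variable {K M : Type*} [Field K] [NeZero (2 : K)] [AddCommGroup M] [Module K M]

lemma disjoint_eigenspace_one_neg_one (f : Module.End K M) :
    Disjoint (f.eigenspace 1) (f.eigenspace (-1)) :=
  Module.End.disjoint_genEigenspace f (fun h => NeZero.ne (2 : K) (by linear_combination h)) 1 1

lemma inf_eigenspace_one_sup_inf_eigenspace_neg_one {f : Module.End K M}
    (hf : Function.Involutive f) {W : Submodule K M} (hW : W ≤ W.comap f) :
    W ⊓ f.eigenspace 1 ⊔ W ⊓ f.eigenspace (-1) = W := by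
  refine le_antisymm (sup_le inf_le_left inf_le_left) fun x hx => ?_
  have hdecomp : x = (2 : K)⁻¹ • (x + f x) + (2 : K)⁻¹ • (x - f x) := by
    rw [← smul_add, add_add_sub_cancel, ← two_smul K x, inv_smul_smul₀ (NeZero.ne 2)]
  rw [hdecomp]
  refine Submodule.add_mem_sup ⟨W.smul_mem _ (add_mem hx (hW hx)), ?_⟩
    ⟨W.smul_mem _ (sub_mem hx (hW hx)), ?_⟩
  · rw [SetLike.mem_coe, Module.End.mem_eigenspace_iff, map_smul, map_add, hf x, one_smul, add_comm]
  · rw [SetLike.mem_coe, Module.End.mem_eigenspace_iff, map_smul, map_sub, hf x, neg_one_smul,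
      ← smul_neg, neg_sub]

end Involution

/-! ### Adjoining a symmetry to a star subalgebra -/

section Symmetry

variable {K R : Type*} [Ring R] [StarRing R]

/-- The star algebra `C + C T` generated by a star subalgebra `C` and a self-adjoint unitary `T`
which normalizes `C`. -/
def adjoinSymmetry [CommSemiring K] [StarRing K] [Algebra K R] [StarModule K R]
    (C : StarSubalgebra K R) {T : R} (hT : IsSelfAdjoint T) (hTT : T * T = 1)
    (hC : ∀ c ∈ C, T * c * T ∈ C) : StarSubalgebra K R where
  carrier := {X | ∃ c ∈ C, ∃ d ∈ C, X = c + d * T}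
  add_mem' := by
    rintro _ _ ⟨c, hc, d, hd, rfl⟩ ⟨c', hc', d', hd', rfl⟩
    exact ⟨_, add_mem hc hc', _, add_mem hd hd', by noncomm_ring⟩
  mul_mem' := by
    rintro _ _ ⟨c, hc, d, hd, rfl⟩ ⟨c', hc', d', hd', rfl⟩
    refine ⟨_, add_mem (mul_mem hc hc') (mul_mem hd (hC d' hd')), _,
      add_mem (mul_mem hc hd') (mul_mem hd (hC c' hc')), ?_⟩
    calc (c + d * T) * (c' + d' * T)
        = c * c' + d * (T * d' * T) + (c * d' * T + d * (T * c')) := by noncomm_ring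
      _ = c * c' + d * (T * d' * T) + (c * d' * T + d * (T * c') * (T * T)) := by
          rw [hTT, mul_one]
      _ = c * c' + d * (T * d' * T) + (c * d' + d * (T * c' * T)) * T := by noncomm_ring
  algebraMap_mem' r := ⟨_, C.algebraMap_mem r, 0, zero_mem C, by rw [zero_mul, add_zero]⟩
  star_mem' := by
    rintro _ ⟨c, hc, d, hd, rfl⟩
    refine ⟨_, star_mem hc, _, hC _ (star_mem hd), ?_⟩
    rw [star_add, star_mul, hT.star_eq, mul_assoc _ T T, hTT, mul_one]

lemma le_adjoinSymmetry [CommSemiring K] [StarRing K] [Algebra K R] [StarModule K R]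
    {C : StarSubalgebra K R} {T : R} (hT : IsSelfAdjoint T) (hTT : T * T = 1)
    (hC : ∀ c ∈ C, T * c * T ∈ C) : C ≤ adjoinSymmetry C hT hTT hC :=
  fun c hc => ⟨c, hc, 0, zero_mem C, by rw [zero_mul, add_zero]⟩

lemma mem_adjoinSymmetry_self [CommSemiring K] [StarRing K] [Algebra K R] [StarModule K R]
    {C : StarSubalgebra K R} {T : R} (hT : IsSelfAdjoint T) (hTT : T * T = 1)
    (hC : ∀ c ∈ C, T * c * T ∈ C) : T ∈ adjoinSymmetry C hT hTT hC :=
  ⟨0, zero_mem C, 1, one_mem C, by rw [one_mul, zero_add]⟩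

/-- Averaging over `σ` projects `C + C T` onto `C`, and its closure onto the closure of `C`. -/
lemma mem_of_dense_adjoinSymmetry [Field K] [NeZero (2 : K)] [StarRing K] [Algebra K R]
    [StarModule K R] [TopologicalSpace R] [ContinuousAdd R] {C : StarSubalgebra K R}
    (hclosed : IsClosed (C : Set R)) {T : R} (hT : IsSelfAdjoint T) (hTT : T * T = 1)
    (hC : ∀ c ∈ C, T * c * T ∈ C) (hdense : Dense (adjoinSymmetry C hT hTT hC : Set R))
    {F : Type*} [FunLike F R R] [RingHomClass F R R] (σ : F) (hσ : Continuous σ)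
    (hσC : ∀ c ∈ C, σ c = c) (hσT : σ T = -T) {X : R} (hX : σ X = X) : X ∈ C := by
  have haverage : X + σ X ∈ (C : Set R) := by
    rw [← hclosed.closure_eq]
    refine map_mem_closure (f := fun Y => Y + σ Y) (continuous_id.add hσ) (hdense X) ?_
    rintro _ ⟨c, hc, d, hd, rfl⟩
    have : c + d * T + σ (c + d * T) = c + c := by
      rw [map_add, map_mul, hσC c hc, hσC d hd, hσT]
      noncomm_ring
    exact Set.mem_of_eq_of_mem this (add_mem hc hc)
  rw [hX, ← two_smul K X] at haverage
  simpa only [inv_smul_smul₀ (NeZero.ne (2 : K))] using C.smul_mem haverage (2 : K)⁻¹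

end Symmetry

variable {𝔄 : ℤ → Type u} [∀ x, CStarAlgebra (𝔄 x)] (ξ : ∀ x, 𝔄 x ≃⋆ₐ[ℂ] M2)

/-! ### Generation of the infinite tensor product by the spin observables -/

lemma span_range_pauli : Submodule.span ℂ (Set.range pauli) = ⊤ := by
  refine Submodule.eq_top_iff'.2 fun M => ?_
  have hM : M = ((M 0 0 + M 1 1) / 2) • pauli 0 + ((M 0 1 + M 1 0) / 2) • pauli 1
      + (Complex.I * (M 0 1 - M 1 0) / 2) • pauli 2 + ((M 0 0 - M 1 1) / 2) • pauli 3 := by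
    have hI := Complex.I_mul_I
    ext i j
    fin_cases i <;> fin_cases j <;> simp [pauli] <;> grind
  have hpauli (κ : Fin 4) (c : ℂ) : c • pauli κ ∈ Submodule.span ℂ (Set.range pauli) :=
    Submodule.smul_mem _ c (Submodule.subset_span ⟨κ, rfl⟩)
  rw [hM]
  exact add_mem (add_mem (add_mem (hpauli 0 _) (hpauli 1 _)) (hpauli 2 _)) (hpauli 3 _)

/-- The identification by `ξ x` of the `2 × 2` matrices with the factor at `x` of the local
algebra over `Λ`. -/
def localSiteHom (Λ : FinZ) (x : Λ.1) : M2 →⋆ₐ[ℂ] LocalAlg ξ Λ where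
  toAlgHom := (PiTensorProduct.singleAlgHom (R := ℂ) (A := fun y : Λ.1 => 𝔄 y) x).comp
    (ξ x).symm.toAlgEquiv.toAlgHom
  map_star' M := by
    change LocalAlg.pure ξ Λ (Pi.mulSingle x ((ξ x).symm (star M)))
      = star (LocalAlg.pure ξ Λ (Pi.mulSingle x ((ξ x).symm M)))
    rw [LocalAlg.star_pure, map_star]
    exact congrArg _ (Pi.star_mulSingle x _).symm

lemma localSiteHom_apply (Λ : FinZ) (x : Λ.1) (M : M2) :
    localSiteHom ξ Λ x M = LocalAlg.pure ξ Λ (Pi.mulSingle x ((ξ x).symm M)) := rfl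

/-- The embedding of the `2 × 2` matrices at the site `x` into the infinite tensor product. -/
def siteHom (x : ℤ) : M2 →⋆ₐ[ℂ] InfAlg ξ :=
  (emb ξ (site x)).comp (localSiteHom ξ (site x) ⟨x, Finset.mem_singleton_self x⟩)

lemma siteHom_pauli (κ : Fin 4) (x : ℤ) : siteHom ξ x (pauli κ) = spin ξ κ x := rfl

variable {ξ}

lemma emb_localSiteHom_mem_of_spin_mem {W : Subalgebra ℂ (InfAlg ξ)} (hW : ∀ κ x, spin ξ κ x ∈ W)
    (Λ : FinZ) (x : Λ.1) (M : M2) : emb ξ Λ (localSiteHom ξ Λ x M) ∈ W := by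
  let f : M2 →ₐ[ℂ] InfAlg ξ := ((emb ξ Λ).comp (localSiteHom ξ Λ x)).toAlgHom
  have hpauli : Submodule.span ℂ (Set.range pauli) ≤ Subalgebra.toSubmodule (W.comap f) := by
    rw [Submodule.span_le]
    rintro _ ⟨κ, rfl⟩
    have hκ : emb ξ Λ (spinLoc ξ Λ κ x) ∈ W := spin_eq ξ κ Λ x ▸ hW κ x
    exact hκ
  exact hpauli (span_range_pauli ▸ Submodule.mem_top)

lemma emb_mem_of_spin_mem {W : Subalgebra ℂ (InfAlg ξ)} (hW : ∀ κ x, spin ξ κ x ∈ W)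
    {Λ : FinZ} (A : LocalAlg ξ Λ) : emb ξ Λ A ∈ W := by
  let pureHom : (∀ x : Λ.1, 𝔄 x) →* LocalAlg ξ Λ :=
    { toFun := LocalAlg.pure ξ Λ
      map_one' := LocalAlg.pure_one ξ Λ
      map_mul' := fun A B => (LocalAlg.pure_mul ξ Λ A B).symm }
  have hpure (A : ∀ x : Λ.1, 𝔄 x) : A ∈ W.toSubmonoid.comap ((emb ξ Λ : _ →* _).comp pureHom) :=
    Submonoid.pi_mem_of_mulSingle_mem A fun x => by
      have := emb_localSiteHom_mem_of_spin_mem hW Λ x (ξ x (A x))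
      rwa [localSiteHom_apply, StarAlgEquiv.symm_apply_apply] at this
  induction A using LocalAlg.induction with
  | smul c A => exact map_smul (emb ξ Λ) c _ ▸ W.smul_mem (hpure A) c
  | add A B hA hB => exact map_add (emb ξ Λ) A B ▸ add_mem hA hB

lemma subalgebra_eq_top_of_spin_mem {W : Subalgebra ℂ (InfAlg ξ)}
    (hclosed : IsClosed (W : Set (InfAlg ξ))) (hW : ∀ κ x, spin ξ κ x ∈ W) : W = ⊤ := by
  refine Algebra.eq_top_iff.2 fun A => ?_
  have hlocal : (⋃ Λ, Set.range (emb ξ Λ)) ⊆ (W : Set (InfAlg ξ)) :=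
    Set.iUnion_subset fun Λ => Set.range_subset_iff.2 (emb_mem_of_spin_mem hW)
  exact closure_minimal hlocal hclosed (dense_iUnion_range_emb A)

/-! ### Spin rotations and the Jordan–Wigner transformation -/

lemma Theta_Theta (A : InfAlg ξ) : Theta ξ (Theta ξ A) = A :=
  infAut_infAut (siteRot_siteRot ξ) A

lemma Theta_Theta'_comm (A : InfAlg ξ) : Theta ξ (Theta' ξ A) = Theta' ξ (Theta ξ A) := by
  let W : Subalgebra ℂ (InfAlg ξ) := AlgHom.equalizer
    (((Theta ξ : InfAlg ξ →⋆ₐ[ℂ] InfAlg ξ).comp (Theta' ξ)).toAlgHom)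
    (((Theta' ξ : InfAlg ξ →⋆ₐ[ℂ] InfAlg ξ).comp (Theta ξ)).toAlgHom)
  have hΘ : Continuous (Theta ξ) := continuous_endCompl _
  have hΘ' : Continuous (Theta' ξ) := continuous_endCompl _
  have hclosed : IsClosed (W : Set (InfAlg ξ)) := isClosed_eq (hΘ.comp hΘ') (hΘ'.comp hΘ)
  have hspin (κ : Fin 4) (x : ℤ) : spin ξ κ x ∈ W := by
    change Theta ξ (Theta' ξ (spin ξ κ x)) = Theta' ξ (Theta ξ (spin ξ κ x))
    rw [Theta_spin, map_smul, Theta'_spin]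
    split_ifs
    · rw [Theta_spin]
    · rw [map_smul, Theta_spin]
  exact Algebra.eq_top_iff.1 (subalgebra_eq_top_of_spin_mem hclosed hspin) A

lemma multiplicator_mem_of_spin_three_mem {S : Type*} [SetLike S (InfAlg ξ)]
    [SubmonoidClass S (InfAlg ξ)] {M : S} (hM : ∀ y, spin ξ 3 y ∈ M)
    (x : ℤ) : multiplicator ξ x ∈ M := by
  have hprod (l : List ℤ) : (l.map (spin ξ 3)).prod ∈ M :=
    list_prod_mem (List.forall_mem_map.2 fun y _ => hM y)
  unfold multiplicator
  split_ifs <;> exact hprod _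

lemma map_multiplicator {F : Type*} [FunLike F (InfAlg ξ) (InfAlg ξ)]
    [MonoidHomClass F (InfAlg ξ) (InfAlg ξ)] {f : F} (hf : ∀ y, f (spin ξ 3 y) = spin ξ 3 y)
    (x : ℤ) : f (multiplicator ξ x) = multiplicator ξ x :=
  multiplicator_mem_of_spin_three_mem
    (M := MonoidHom.eqLocusM (f : InfAlg ξ →* InfAlg ξ) (MonoidHom.id _)) hf x

lemma Theta_multiplicator (x : ℤ) : Theta ξ (multiplicator ξ x) = multiplicator ξ x :=
  map_multiplicator (fun y => by simp [Theta_spin, pauliSign]) x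

lemma Theta'_multiplicator (x : ℤ) : Theta' ξ (multiplicator ξ x) = multiplicator ξ x :=
  map_multiplicator (fun y => by simp [Theta'_spin, pauliSign]) x

lemma multiplicator_mem_unitary (x : ℤ) : multiplicator ξ x ∈ unitary (InfAlg ξ) := by
  refine multiplicator_mem_of_spin_three_mem (fun y => ?_) x
  have hpauli : pauli 3 ∈ unitary M2 := by
    rw [Unitary.mem_iff, star_pauli_three, pauli_three_mul_self, and_self]
  exact Unitary.map_mem (siteHom ξ y) hpauli

lemma lowering_eq_siteHom (x : ℤ) : lowering ξ x = siteHom ξ x !![0, 0; 1, 0] := by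
  have hmatrix : (!![0, 0; 1, 0] : M2) = (1 / 2 : ℂ) • (pauli 1 - Complex.I • pauli 2) := by
    ext i j
    fin_cases i <;> fin_cases j <;> simp [pauli, one_add_one_eq_two]
  rw [hmatrix, map_smul, map_sub, map_smul, siteHom_pauli, siteHom_pauli, lowering]

lemma star_lowering_eq_siteHom (x : ℤ) : star (lowering ξ x) = siteHom ξ x !![0, 1; 0, 0] := by
  rw [lowering_eq_siteHom, ← map_star]
  congr 1
  ext i j
  fin_cases i <;> fin_cases j <;> simp

lemma spin_zero (x : ℤ) : spin ξ 0 x = 1 := map_one (siteHom ξ x)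

lemma spin_one_eq_lowering_add_star (x : ℤ) : spin ξ 1 x = lowering ξ x + star (lowering ξ x) := by
  rw [star_lowering_eq_siteHom, lowering_eq_siteHom, ← map_add, ← siteHom_pauli]
  congr 1
  ext i j
  fin_cases i <;> fin_cases j <;> simp [pauli]

lemma spin_two_eq_lowering_sub_star (x : ℤ) :
    spin ξ 2 x = Complex.I • (lowering ξ x - star (lowering ξ x)) := by
  rw [star_lowering_eq_siteHom, lowering_eq_siteHom, ← map_sub, ← map_smul, ← siteHom_pauli]
  congr 1
  ext i j
  fin_cases i <;> fin_cases j <;> simp [pauli]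

lemma spin_three_eq_star_lowering_mul_self (x : ℤ) :
    spin ξ 3 x = (2 : ℂ) • (star (lowering ξ x) * lowering ξ x) - 1 := by
  rw [star_lowering_eq_siteHom, lowering_eq_siteHom, ← map_mul, ← map_smul,
    ← map_one (siteHom ξ x), ← map_sub, ← siteHom_pauli]
  congr 1
  ext i j
  fin_cases i <;> fin_cases j <;> simp [pauli, eq_sub_iff_add_eq, one_add_one_eq_two]

lemma star_lowering_mul_self_add_mul_star (x : ℤ) :
    star (lowering ξ x) * lowering ξ x + lowering ξ x * star (lowering ξ x) = 1 := by
  rw [star_lowering_eq_siteHom, lowering_eq_siteHom, ← map_mul (siteHom ξ x),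
    ← map_mul (siteHom ξ x), ← map_add (siteHom ξ x), ← map_one (siteHom ξ x)]
  congr 1
  ext i j
  fin_cases i <;> fin_cases j <;> simp

lemma Theta_lowering (x : ℤ) : Theta ξ (lowering ξ x) = -lowering ξ x := by
  simp only [lowering, map_smul, map_sub, Theta_spin, pauliSign, Matrix.cons_val]
  module

lemma Theta'_lowering (x : ℤ) :
    Theta' ξ (lowering ξ x) = if 1 ≤ x then lowering ξ x else -lowering ξ x := by
  simp only [lowering, map_smul, map_sub, Theta'_spin, pauliSign, Matrix.cons_val]
  split_ifs <;> module

/-- The Jordan–Wigner operators determine `σ_-^{(x)}`: the products `σ_-^{(y)*} σ_-^{(y)}` do not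
see the unitaries `S_y`, and they recover `σ_3^{(y)}` and hence `S_x`. -/
lemma lowering_mem_of_multiplicator_mul_mem {W : StarSubalgebra ℂ (InfAlg ξ)}
    (hW : ∀ x, multiplicator ξ x * lowering ξ x ∈ W) (x : ℤ) : lowering ξ x ∈ W := by
  have hstar_mul (x : ℤ) (A : InfAlg ξ) :
      star (multiplicator ξ x) * (multiplicator ξ x * A) = A := by
    rw [← mul_assoc, Unitary.star_mul_self_of_mem (multiplicator_mem_unitary x), one_mul]
  have hthree (y : ℤ) : spin ξ 3 y ∈ W := by
    have hnumber : star (lowering ξ y) * lowering ξ y ∈ W := by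
      have := mul_mem (star_mem (hW y)) (hW y)
      rwa [star_mul, mul_assoc, hstar_mul] at this
    rw [spin_three_eq_star_lowering_mul_self]
    exact sub_mem (W.smul_mem hnumber 2) (one_mem W)
  rw [← hstar_mul x (lowering ξ x)]
  exact mul_mem (star_mem (multiplicator_mem_of_spin_three_mem hthree x)) (hW x)

lemma eq_top_of_multiplicator_mul_lowering_mem {W : StarSubalgebra ℂ (InfAlg ξ)}
    (hclosed : IsClosed (W : Set (InfAlg ξ)))
    (hW : ∀ x, multiplicator ξ x * lowering ξ x ∈ W) : W = ⊤ := by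
  have hlowering := lowering_mem_of_multiplicator_mul_mem hW
  have hstar (x : ℤ) : star (lowering ξ x) ∈ W := star_mem (hlowering x)
  have hspin : ∀ κ x, spin ξ κ x ∈ W.toSubalgebra
    | 0, x => by
      rw [spin_zero]
      exact one_mem W
    | 1, x => by
      rw [spin_one_eq_lowering_add_star]
      exact add_mem (hlowering x) (hstar x)
    | 2, x => by
      rw [spin_two_eq_lowering_sub_star]
      exact W.smul_mem (sub_mem (hlowering x) (hstar x)) _
    | 3, x => by
      rw [spin_three_eq_star_lowering_mul_self]
      exact sub_mem (W.smul_mem (mul_mem (hstar x) (hlowering x)) 2) (one_mem W)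
  refine StarSubalgebra.toSubalgebra_injective ?_
  rw [subalgebra_eq_top_of_spin_mem hclosed hspin, StarSubalgebra.top_toSubalgebra]

/-! ### The crossed product by `Θ'` and its automorphisms -/

lemma anchor_mul_self : anchor ξ * anchor ξ = 1 :=
  Subtype.ext ((hatMatrix_mul ξ 0 1 0 1).trans (by simpa using hatMatrix_algebraMap ξ 1))

lemma isSelfAdjoint_anchor : IsSelfAdjoint (anchor ξ) :=
  Subtype.ext ((hatMatrix_star ξ 0 1).trans (by simp [anchor]))

lemma anchor_mul_psi (A : InfAlg ξ) : anchor ξ * psi ξ A = psi ξ (Theta' ξ A) * anchor ξ :=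
  Subtype.ext <| (hatMatrix_mul ξ 0 1 A 0).trans <|
    Eq.trans (by simp) (hatMatrix_mul ξ (Theta' ξ A) 0 0 1).symm

lemma eq_psi_add_psi_mul_anchor (X : Hat ξ) :
    X = psi ξ (X.1 0 0) + psi ξ (X.1 0 1) * anchor ξ := by
  obtain ⟨_, A, B, rfl⟩ := X
  refine Subtype.ext ?_
  change hatMatrix ξ A B = hatMatrix ξ A 0 + hatMatrix ξ B 0 * hatMatrix ξ 0 1
  simp [hatMatrix_mul, hatMatrix_add]

section Lift

variable {R : Type*} [Ring R] [StarRing R] [Algebra ℂ R]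

lemma hat_hom_ext {f g : Hat ξ →⋆ₐ[ℂ] R} (hpsi : ∀ A, f (psi ξ A) = g (psi ξ A))
    (hanchor : f (anchor ξ) = g (anchor ξ)) : f = g := by
  refine StarAlgHom.ext fun X => ?_
  rw [eq_psi_add_psi_mul_anchor X, map_add, map_add, map_mul, map_mul, hpsi, hpsi, hanchor]

/-- The universal property of the crossed product: a covariant pair of a representation of the
infinite tensor product and a self-adjoint unitary which implements `Θ'` extends to it. -/
def hatLift (f : InfAlg ξ →⋆ₐ[ℂ] R) {U : R} (hU : IsSelfAdjoint U) (hUU : U * U = 1)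
    (hcov : ∀ A, U * f A = f (Theta' ξ A) * U) : Hat ξ →⋆ₐ[ℂ] R where
  toFun X := f (X.1 0 0) + f (X.1 0 1) * U
  map_one' := by simp
  map_zero' := by simp
  map_add' X Y := by simp [add_mul, add_add_add_comm]
  map_mul' := by
    rintro ⟨_, A, B, rfl⟩ ⟨_, C, D, rfl⟩
    change f ((hatMatrix ξ A B * hatMatrix ξ C D) 0 0)
      + f ((hatMatrix ξ A B * hatMatrix ξ C D) 0 1) * U = (f A + f B * U) * (f C + f D * U)
    rw [hatMatrix_mul]
    change f (A * C + B * Theta' ξ D) + f (A * D + B * Theta' ξ C) * U = _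
    simp only [map_add, map_mul]
    symm
    calc (f A + f B * U) * (f C + f D * U)
        = f A * f C + f B * (U * f D) * U + (f A * f D * U + f B * (U * f C)) := by noncomm_ring
      _ = f A * f C + f B * f (Theta' ξ D) * (U * U)
          + (f A * f D + f B * f (Theta' ξ C)) * U := by rw [hcov, hcov]; noncomm_ring
      _ = _ := by rw [hUU, mul_one]
  commutes' c := by
    rw [← AlgHomClass.commutes f c]
    simp [Algebra.algebraMap_eq_smul_one]
  map_star' := by
    rintro ⟨_, A, B, rfl⟩
    change f (star (hatMatrix ξ A B) 0 0) + f (star (hatMatrix ξ A B) 0 1) * U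
      = star (f A + f B * U)
    rw [hatMatrix_star]
    change f (star A) + f (star (Theta' ξ B)) * U = _
    rw [star_add, star_mul, hU.star_eq, ← map_star f, ← map_star f, hcov, map_star (Theta' ξ)]

variable (f : InfAlg ξ →⋆ₐ[ℂ] R) {U : R} (hU : IsSelfAdjoint U) (hUU : U * U = 1)
    (hcov : ∀ A, U * f A = f (Theta' ξ A) * U)

lemma hatLift_psi (A : InfAlg ξ) : hatLift f hU hUU hcov (psi ξ A) = f A := by
  change f A + f 0 * U = f A
  rw [map_zero, zero_mul, add_zero]

lemma hatLift_anchor : hatLift f hU hUU hcov (anchor ξ) = U := by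
  change f 0 + f 1 * U = U
  rw [map_zero, map_one, one_mul, zero_add]

end Lift

/-- The automorphism given by an endomorphism which is an involution on `ψ(𝔄)` and on `T`. -/
def hatInvolution (f : Hat ξ →⋆ₐ[ℂ] Hat ξ) (hpsi : ∀ A, f (f (psi ξ A)) = psi ξ A)
    (hanchor : f (f (anchor ξ)) = anchor ξ) : Hat ξ ≃⋆ₐ[ℂ] Hat ξ :=
  have hf : f.comp f = StarAlgHom.id ℂ (Hat ξ) := hat_hom_ext hpsi hanchor
  StarAlgEquiv.ofStarAlgHom f f hf hf

lemma hatTheta_covariant (A : InfAlg ξ) :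
    anchor ξ * psi ξ (Theta ξ A) = psi ξ (Theta ξ (Theta' ξ A)) * anchor ξ := by
  rw [anchor_mul_psi, Theta_Theta'_comm]

lemma isSelfAdjoint_neg_anchor : IsSelfAdjoint (-anchor ξ) :=
  (star_neg (anchor ξ)).trans (congrArg _ isSelfAdjoint_anchor)

lemma neg_anchor_mul_neg_anchor : -anchor ξ * -anchor ξ = 1 :=
  (neg_mul_neg (anchor ξ) (anchor ξ)).trans anchor_mul_self

lemma dualAction_covariant (A : InfAlg ξ) :
    -anchor ξ * psi ξ A = psi ξ (Theta' ξ A) * -anchor ξ := by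
  rw [neg_mul (anchor ξ), anchor_mul_psi, mul_neg _ (anchor ξ)]

variable (ξ)

/-- The spin rotation `Θ̂` of the crossed product, as an endomorphism. -/
def hatThetaHom : Hat ξ →⋆ₐ[ℂ] Hat ξ :=
  hatLift ((psi ξ).comp (Theta ξ : InfAlg ξ →⋆ₐ[ℂ] InfAlg ξ)) isSelfAdjoint_anchor anchor_mul_self
    hatTheta_covariant

/-- The dual action `γ` on the crossed product, which fixes `ψ(𝔄)` and changes the sign of `T`,
as an endomorphism. -/
def dualActionHom : Hat ξ →⋆ₐ[ℂ] Hat ξ :=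
  hatLift (psi ξ) isSelfAdjoint_neg_anchor neg_anchor_mul_neg_anchor dualAction_covariant

variable {ξ}

lemma hatThetaHom_psi (A : InfAlg ξ) : hatThetaHom ξ (psi ξ A) = psi ξ (Theta ξ A) :=
  hatLift_psi _ _ _ hatTheta_covariant A

lemma hatThetaHom_anchor : hatThetaHom ξ (anchor ξ) = anchor ξ :=
  hatLift_anchor _ _ _ hatTheta_covariant

lemma dualActionHom_psi (A : InfAlg ξ) : dualActionHom ξ (psi ξ A) = psi ξ A :=
  hatLift_psi _ _ _ dualAction_covariant A

lemma dualActionHom_anchor : dualActionHom ξ (anchor ξ) = -anchor ξ :=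
  hatLift_anchor _ _ _ dualAction_covariant

variable (ξ)

/-- The spin rotation `Θ̂` of the crossed product. -/
def hatTheta : Hat ξ ≃⋆ₐ[ℂ] Hat ξ :=
  hatInvolution (hatThetaHom ξ)
    (fun A => by rw [hatThetaHom_psi, hatThetaHom_psi, Theta_Theta])
    (by rw [hatThetaHom_anchor, hatThetaHom_anchor])

/-- The dual action `γ` on the crossed product, which fixes `ψ(𝔄)` and changes the sign of `T`. -/
def dualAction : Hat ξ ≃⋆ₐ[ℂ] Hat ξ :=
  hatInvolution (dualActionHom ξ)
    (fun A => by rw [dualActionHom_psi, dualActionHom_psi])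
    (by rw [dualActionHom_anchor, map_neg (dualActionHom ξ), dualActionHom_anchor, neg_neg])

/-- The automorphism `γ Θ̂`, whose fixed points form the CAR subalgebra. -/
def twistedTheta : Hat ξ ≃⋆ₐ[ℂ] Hat ξ := (hatTheta ξ).trans (dualAction ξ)

variable {ξ}

lemma hatTheta_psi (A : InfAlg ξ) : hatTheta ξ (psi ξ A) = psi ξ (Theta ξ A) :=
  hatThetaHom_psi A

lemma hatTheta_anchor : hatTheta ξ (anchor ξ) = anchor ξ := hatThetaHom_anchor

lemma dualAction_psi (A : InfAlg ξ) : dualAction ξ (psi ξ A) = psi ξ A := dualActionHom_psi A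

lemma dualAction_anchor : dualAction ξ (anchor ξ) = -anchor ξ :=
  dualActionHom_anchor

lemma twistedTheta_apply (X : Hat ξ) : twistedTheta ξ X = dualAction ξ (hatTheta ξ X) := rfl

lemma hatTheta_hatTheta (X : Hat ξ) : hatTheta ξ (hatTheta ξ X) = X := (hatTheta ξ).left_inv X

lemma dualAction_dualAction (X : Hat ξ) : dualAction ξ (dualAction ξ X) = X :=
  (dualAction ξ).left_inv X

lemma eq_hatTheta {θ : Hat ξ ≃⋆ₐ[ℂ] Hat ξ} (hpsi : ∀ A, θ (psi ξ A) = psi ξ (Theta ξ A))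
    (hanchor : θ (anchor ξ) = anchor ξ) : θ = hatTheta ξ := by
  have h : (θ : Hat ξ →⋆ₐ[ℂ] Hat ξ) = (hatTheta ξ : Hat ξ →⋆ₐ[ℂ] Hat ξ) :=
    hat_hom_ext (fun A => (hpsi A).trans (hatTheta_psi A).symm) (hanchor.trans hatTheta_anchor.symm)
  exact StarAlgEquiv.ext fun X => DFunLike.congr_fun (F := Hat ξ →⋆ₐ[ℂ] Hat ξ) h X

lemma dualAction_hatTheta_comm (X : Hat ξ) :
    dualAction ξ (hatTheta ξ X) = hatTheta ξ (dualAction ξ X) := by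
  have h : (dualAction ξ : Hat ξ →⋆ₐ[ℂ] Hat ξ).comp (hatTheta ξ : Hat ξ →⋆ₐ[ℂ] Hat ξ)
      = (hatTheta ξ : Hat ξ →⋆ₐ[ℂ] Hat ξ).comp (dualAction ξ : Hat ξ →⋆ₐ[ℂ] Hat ξ) := by
    refine hat_hom_ext (fun A => ?_) ?_
    · change dualAction ξ (hatTheta ξ (psi ξ A)) = hatTheta ξ (dualAction ξ (psi ξ A))
      rw [hatTheta_psi, dualAction_psi, dualAction_psi, hatTheta_psi]
    · change dualAction ξ (hatTheta ξ (anchor ξ)) = hatTheta ξ (dualAction ξ (anchor ξ))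
      rw [hatTheta_anchor, dualAction_anchor, map_neg (hatTheta ξ), hatTheta_anchor]
  exact DFunLike.congr_fun h X

lemma twistedTheta_twistedTheta (X : Hat ξ) : twistedTheta ξ (twistedTheta ξ X) = X := by
  rw [twistedTheta_apply, twistedTheta_apply, ← dualAction_hatTheta_comm, hatTheta_hatTheta,
    dualAction_dualAction]

lemma Hat0_eq_evenPart : Hat0 ξ = evenPart (dualAction ξ) Set.univ := by
  refine Set.Subset.antisymm (Set.range_subset_iff.2 fun A => ⟨trivial, dualAction_psi A⟩) ?_
  rintro X ⟨-, hX⟩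
  rw [eq_psi_add_psi_mul_anchor X, map_add, map_mul, dualAction_psi, dualAction_psi,
    dualAction_anchor, mul_neg _ (anchor ξ)] at hX
  have hzero : psi ξ (X.1 0 1) * anchor ξ = 0 :=
    haveI := IsAddTorsionFree.of_isTorsionFree ℂ (Hat ξ)
    self_eq_neg.1 (add_left_cancel hX).symm
  exact ⟨X.1 0 0, by conv_rhs => rw [eq_psi_add_psi_mul_anchor X, hzero, add_zero]⟩

lemma continuous_hat_apply (i j : Fin 2) : Continuous fun X : Hat ξ => X.1 i j := by
  have h : Continuous fun X : CStarMatrix (Fin 2) (Fin 2) (InfAlg ξ) => X i j :=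
    continuous_apply_apply (ρ := fun _ _ => InfAlg ξ) i j
  exact h.comp continuous_subtype_val

lemma continuous_psi : Continuous (psi ξ) := by
  refine Continuous.subtype_mk ?_ _
  change Continuous fun A => (!![A, 0; Theta' ξ 0, Theta' ξ A] : Matrix (Fin 2) (Fin 2) (InfAlg ξ))
  refine continuous_matrix fun i j => ?_
  fin_cases i <;> fin_cases j
  · exact continuous_id
  · exact continuous_const
  · exact continuous_const
  · exact continuous_endCompl _

lemma continuous_hatLift {R : Type*} [Ring R] [StarRing R] [Algebra ℂ R] [TopologicalSpace R]
    [IsTopologicalSemiring R] {f : InfAlg ξ →⋆ₐ[ℂ] R} (hf : Continuous f) {U : R}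
    (hU : IsSelfAdjoint U) (hUU : U * U = 1) (hcov : ∀ A, U * f A = f (Theta' ξ A) * U) :
    Continuous (hatLift f hU hUU hcov) :=
  (hf.comp (continuous_hat_apply 0 0)).add
    ((hf.comp (continuous_hat_apply 0 1)).mul continuous_const)

lemma continuous_hatThetaHom : Continuous (hatThetaHom ξ) :=
  have h : Continuous ((psi ξ).comp (Theta ξ : InfAlg ξ →⋆ₐ[ℂ] InfAlg ξ)) :=
    continuous_psi.comp (continuous_endCompl (fun x => siteRot ξ x))
  continuous_hatLift h isSelfAdjoint_anchor anchor_mul_self hatTheta_covariant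

lemma continuous_hatTheta : Continuous (hatTheta ξ) := continuous_hatThetaHom

lemma continuous_dualAction : Continuous (dualAction ξ) :=
  continuous_hatLift continuous_psi isSelfAdjoint_neg_anchor neg_anchor_mul_neg_anchor
    dualAction_covariant

lemma continuous_twistedTheta : Continuous (twistedTheta ξ) :=
  continuous_dualAction.comp continuous_hatTheta

/-! ### Even and odd parts -/

section Grading

variable {θ : Hat ξ ≃⋆ₐ[ℂ] Hat ξ} {C : Set (Hat ξ)}

lemma IsUnitalCStarSubalgebra.isClosedStarSubspace (hC : IsUnitalCStarSubalgebra C) :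
    IsClosedStarSubspace C := by
  obtain ⟨hclosed, B, rfl⟩ := hC
  exact ⟨hclosed, ⟨Subalgebra.toSubmodule B.toSubalgebra, rfl⟩, fun _ hA => star_mem hA⟩

lemma isUnitalCStarSubalgebra_univ : IsUnitalCStarSubalgebra (Set.univ : Set (Hat ξ)) :=
  ⟨isClosed_univ, ⊤, StarSubalgebra.coe_top⟩

lemma IsUnitalCStarSubalgebra.evenPart (hC : IsUnitalCStarSubalgebra C) (hθ : Continuous θ) :
    IsUnitalCStarSubalgebra (evenPart θ C) := by
  obtain ⟨hclosed, B, rfl⟩ := hC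
  exact ⟨hclosed.inter (isClosed_eq hθ continuous_id),
    B ⊓ StarAlgHom.equalizer (θ : Hat ξ →⋆ₐ[ℂ] Hat ξ) (StarAlgHom.id ℂ (Hat ξ)), rfl⟩

lemma coe_inf_eigenspace_one (W : Submodule ℂ (Hat ξ)) :
    ((W ⊓ Module.End.eigenspace (θ : Hat ξ →ₗ[ℂ] Hat ξ) 1 : Submodule ℂ (Hat ξ)) : Set (Hat ξ))
      = evenPart θ W := by
  ext X
  exact and_congr_right fun _ => by
    rw [SetLike.mem_coe, Module.End.mem_eigenspace_iff, one_smul]; rfl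

lemma coe_inf_eigenspace_neg_one (W : Submodule ℂ (Hat ξ)) :
    ((W ⊓ Module.End.eigenspace (θ : Hat ξ →ₗ[ℂ] Hat ξ) (-1) : Submodule ℂ (Hat ξ)) : Set (Hat ξ))
      = oddPart θ W := by
  ext X
  exact and_congr_right fun _ => by
    rw [SetLike.mem_coe, Module.End.mem_eigenspace_iff, neg_one_smul]; rfl

lemma IsClosedStarSubspace.oddPart (hC : IsClosedStarSubspace C) (hθ : Continuous θ) :
    IsClosedStarSubspace (oddPart θ C) := by
  obtain ⟨hclosed, ⟨W, rfl⟩, hstar⟩ := hC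
  refine ⟨hclosed.inter (isClosed_eq hθ continuous_neg), ⟨_, coe_inf_eigenspace_neg_one W⟩, ?_⟩
  rintro A ⟨hA, hodd⟩
  exact ⟨hstar A hA, by rw [map_star θ, hodd, star_neg A]⟩

lemma isDirectSum_evenPart_oddPart (hC : ∃ W : Submodule ℂ (Hat ξ), (W : Set (Hat ξ)) = C)
    (hθ : Function.Involutive θ) (hθC : Set.MapsTo θ C C) :
    IsDirectSum C (evenPart θ C) (oddPart θ C) := by
  obtain ⟨W, rfl⟩ := hC
  exact ⟨_, _, coe_inf_eigenspace_one W, coe_inf_eigenspace_neg_one W,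
    congrArg _ (inf_eigenspace_one_sup_inf_eigenspace_neg_one hθ hθC),
    (disjoint_eigenspace_one_neg_one _).mono inf_le_right inf_le_right⟩

lemma mapsTo_evenPart_of_comm {σ : Hat ξ ≃⋆ₐ[ℂ] Hat ξ} (h : ∀ X, σ (θ X) = θ (σ X)) :
    Set.MapsTo θ (evenPart σ Set.univ) (evenPart σ Set.univ) :=
  fun X hX => ⟨trivial, (h X).trans (congrArg θ hX.2)⟩

end Grading

/-! ### The CAR subalgebra -/

variable (ξ)

/-- The CAR subalgebra `𝔄̂₁` as a bundled object. It is unital by `one_mem_carSubalgebra`, but its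
definition only asks for closed star subalgebras which contain the annihilation operators. -/
def carSubalgebra : NonUnitalStarSubalgebra ℂ (Hat ξ) :=
  sInf {B | IsClosed (B : Set (Hat ξ)) ∧ Set.range (annihilation ξ) ⊆ B}

variable {ξ}

lemma coe_carSubalgebra : (carSubalgebra ξ : Set (Hat ξ)) = Hat1 ξ :=
  NonUnitalStarAlgebra.coe_sInf _

lemma isClosed_carSubalgebra : IsClosed (carSubalgebra ξ : Set (Hat ξ)) := by
  rw [coe_carSubalgebra]
  exact isClosed_biInter fun B hB => hB.1

lemma annihilation_mem_carSubalgebra (x : ℤ) : annihilation ξ x ∈ carSubalgebra ξ :=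
  NonUnitalStarAlgebra.mem_sInf.2 fun _ hB => hB.2 ⟨x, rfl⟩

lemma carSubalgebra_le {B : NonUnitalStarSubalgebra ℂ (Hat ξ)} (hB : IsClosed (B : Set (Hat ξ)))
    (h : ∀ x, annihilation ξ x ∈ B) : carSubalgebra ξ ≤ B :=
  sInf_le ⟨hB, Set.range_subset_iff.2 h⟩

lemma annihilation_eq_psi_mul_anchor (x : ℤ) : annihilation ξ x =
    psi ξ (multiplicator ξ x * if 1 ≤ x then lowering ξ x else -lowering ξ x) * anchor ξ := by
  rw [annihilation, anchor_mul_psi, map_mul, Theta'_multiplicator, Theta'_lowering]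

lemma anchor_mul_annihilation (x : ℤ) :
    anchor ξ * annihilation ξ x = psi ξ (multiplicator ξ x * lowering ξ x) := by
  rw [annihilation, ← mul_assoc, anchor_mul_self, one_mul]

lemma multiplicator_one : multiplicator ξ 1 = 1 := by
  simp [multiplicator, Int.range]

/-- The anticommutator of `a_1 = T ψ(σ_-)` and its adjoint is `1`, since `S_1 = 1`. -/
lemma one_mem_carSubalgebra : 1 ∈ carSubalgebra ξ := by
  have ha := annihilation_mem_carSubalgebra (ξ := ξ) 1
  have hanticomm : star (annihilation ξ 1) * annihilation ξ 1
      + annihilation ξ 1 * star (annihilation ξ 1) = 1 := by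
    have hright : annihilation ξ 1 = psi ξ (lowering ξ 1) * anchor ξ := by
      rw [annihilation_eq_psi_mul_anchor, multiplicator_one, one_mul, if_pos le_rfl]
    have hleft : annihilation ξ 1 = anchor ξ * psi ξ (lowering ξ 1) := by
      rw [annihilation, multiplicator_one, one_mul]
    calc star (annihilation ξ 1) * annihilation ξ 1 + annihilation ξ 1 * star (annihilation ξ 1)
        = psi ξ (star (lowering ξ 1)) * (anchor ξ * anchor ξ) * psi ξ (lowering ξ 1)
          + psi ξ (lowering ξ 1) * (anchor ξ * anchor ξ) * psi ξ (star (lowering ξ 1)) := by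
          nth_rw 3 4 [hright]
          rw [hleft, star_mul, star_mul, isSelfAdjoint_anchor.star_eq, map_star]
          simp only [mul_assoc]
      _ = 1 := by
          rw [anchor_mul_self, mul_one, mul_one, ← map_mul, ← map_mul, ← map_add,
            star_lowering_mul_self_add_mul_star, map_one]
  exact hanticomm ▸ add_mem (mul_mem (star_mem ha) ha) (mul_mem ha (star_mem ha))

variable (ξ)

/-- The conjugation by the self-adjoint unitary `T`. -/
def anchorConj : Hat ξ ≃⋆ₐ[ℂ] Hat ξ :=
  Unitary.conjStarAlgAut ℂ (Hat ξ) ⟨anchor ξ, by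
    rw [Unitary.mem_iff, isSelfAdjoint_anchor.star_eq, anchor_mul_self, and_self]⟩

variable {ξ}

lemma anchorConj_apply (X : Hat ξ) : anchorConj ξ X = anchor ξ * X * anchor ξ :=
  congrArg (anchor ξ * X * ·) isSelfAdjoint_anchor.star_eq

lemma continuous_anchorConj : Continuous (anchorConj ξ) :=
  (continuous_const.mul continuous_id).mul continuous_const

lemma anchorConj_annihilation (x : ℤ) : anchorConj ξ (annihilation ξ x)
    = if 1 ≤ x then annihilation ξ x else -annihilation ξ x := by
  rw [anchorConj_apply, anchor_mul_annihilation, annihilation_eq_psi_mul_anchor]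
  split_ifs
  · rfl
  · rw [mul_neg, map_neg (psi ξ), neg_mul (psi ξ _), neg_neg]

lemma anchorConj_mem_carSubalgebra {X : Hat ξ} (hX : X ∈ carSubalgebra ξ) :
    anchorConj ξ X ∈ carSubalgebra ξ := by
  have hle : carSubalgebra ξ ≤ (carSubalgebra ξ).comap (anchorConj ξ) := by
    refine carSubalgebra_le (isClosed_carSubalgebra.preimage continuous_anchorConj) fun x => ?_
    have ha := annihilation_mem_carSubalgebra (ξ := ξ) x
    rw [NonUnitalStarSubalgebra.mem_comap, anchorConj_annihilation]
    split_ifs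
    · exact ha
    · exact neg_mem ha
  exact hle hX

variable (ξ)

/-- The CAR subalgebra `𝔄̂₁` as a unital star subalgebra. -/
def unitalCarSubalgebra : StarSubalgebra ℂ (Hat ξ) where
  __ := carSubalgebra ξ
  one_mem' := one_mem_carSubalgebra
  algebraMap_mem' c := by
    rw [Algebra.algebraMap_eq_smul_one]
    exact (carSubalgebra ξ).smul_mem' c one_mem_carSubalgebra

variable {ξ}

lemma anchor_mul_mul_anchor_mem_unitalCarSubalgebra : ∀ X ∈ unitalCarSubalgebra ξ,
    anchor ξ * X * anchor ξ ∈ unitalCarSubalgebra ξ :=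
  fun X hX => anchorConj_apply X ▸ anchorConj_mem_carSubalgebra hX

lemma dense_adjoinSymmetry_carSubalgebra :
    Dense (adjoinSymmetry (unitalCarSubalgebra ξ) isSelfAdjoint_anchor anchor_mul_self
      anchor_mul_mul_anchor_mem_unitalCarSubalgebra : Set (Hat ξ)) := by
  set D := adjoinSymmetry (unitalCarSubalgebra ξ) isSelfAdjoint_anchor anchor_mul_self
      anchor_mul_mul_anchor_mem_unitalCarSubalgebra
  have hanchor : anchor ξ ∈ D.topologicalClosure :=
    D.le_topologicalClosure (mem_adjoinSymmetry_self _ _ _)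
  have hannihilation (x : ℤ) : annihilation ξ x ∈ D.topologicalClosure :=
    D.le_topologicalClosure (le_adjoinSymmetry _ _ _ (annihilation_mem_carSubalgebra x))
  have hcomap : D.topologicalClosure.comap (psi ξ) = ⊤ :=
    eq_top_of_multiplicator_mul_lowering_mem
      (D.isClosed_topologicalClosure.preimage continuous_psi) fun x =>
        show psi ξ _ ∈ D.topologicalClosure from
          anchor_mul_annihilation (ξ := ξ) x ▸ mul_mem hanchor (hannihilation x)
  have hpsi (A : InfAlg ξ) : psi ξ A ∈ D.topologicalClosure :=
    show A ∈ D.topologicalClosure.comap (psi ξ) from hcomap ▸ StarSubalgebra.mem_top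
  intro X
  rw [← D.topologicalClosure_coe, eq_psi_add_psi_mul_anchor X]
  exact add_mem (hpsi _) (mul_mem (hpsi _) hanchor)

lemma twistedTheta_anchor : twistedTheta ξ (anchor ξ) = -anchor ξ := by
  rw [twistedTheta_apply, hatTheta_anchor, dualAction_anchor]

lemma twistedTheta_annihilation (x : ℤ) : twistedTheta ξ (annihilation ξ x) = annihilation ξ x := by
  have hodd : Theta ξ (multiplicator ξ x * lowering ξ x) = -(multiplicator ξ x * lowering ξ x) := by
    rw [map_mul, Theta_multiplicator, Theta_lowering, mul_neg]
  rw [annihilation, map_mul, twistedTheta_anchor, twistedTheta_apply, hatTheta_psi, dualAction_psi,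
    hodd, map_neg (psi ξ)]
  exact neg_mul_neg (anchor ξ) (psi ξ (multiplicator ξ x * lowering ξ x))

lemma twistedTheta_eq_of_mem_carSubalgebra {X : Hat ξ} (hX : X ∈ carSubalgebra ξ) :
    twistedTheta ξ X = X := by
  let B : StarSubalgebra ℂ (Hat ξ) :=
    StarAlgHom.equalizer (twistedTheta ξ : Hat ξ →⋆ₐ[ℂ] Hat ξ) (StarAlgHom.id ℂ (Hat ξ))
  have hle : carSubalgebra ξ ≤ B.toNonUnitalStarSubalgebra :=
    carSubalgebra_le (isClosed_eq continuous_twistedTheta continuous_id) twistedTheta_annihilation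
  exact hle hX

lemma Hat1_eq_evenPart : Hat1 ξ = evenPart (twistedTheta ξ) Set.univ := by
  rw [← coe_carSubalgebra]
  refine Set.Subset.antisymm
    (fun X hX => ⟨trivial, twistedTheta_eq_of_mem_carSubalgebra hX⟩) fun X hX => ?_
  exact mem_of_dense_adjoinSymmetry (C := unitalCarSubalgebra ξ) isClosed_carSubalgebra
    isSelfAdjoint_anchor anchor_mul_self anchor_mul_mul_anchor_mem_unitalCarSubalgebra
    dense_adjoinSymmetry_carSubalgebra (twistedTheta ξ) continuous_twistedTheta
    (fun _ hc => twistedTheta_eq_of_mem_carSubalgebra hc) twistedTheta_anchor hX.2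

/-! ### Comparison of the spin and the CAR subalgebra -/

lemma mem_mulAnchor {C : Set (Hat ξ)} {X : Hat ξ} : X ∈ mulAnchor C ↔ X * anchor ξ ∈ C := by
  refine ⟨?_, fun hX => ⟨_, hX, ?_⟩⟩
  · rintro ⟨Y, hY, rfl⟩
    simpa only [mul_assoc, anchor_mul_self, mul_one] using hY
  · simp only [mul_assoc, anchor_mul_self, mul_one]

lemma evenPart_hatTheta_Hat1 :
    evenPart (hatTheta ξ) (Hat1 ξ) = evenPart (hatTheta ξ) (Hat0 ξ) := by
  rw [Hat1_eq_evenPart, Hat0_eq_evenPart]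
  ext X
  refine and_congr_left fun hX => and_congr_right fun _ => ?_
  rw [twistedTheta_apply, hX]

lemma map_mul_anchor {σ : Hat ξ ≃⋆ₐ[ℂ] Hat ξ} (hσ : σ (anchor ξ) = -anchor ξ) (X : Hat ξ) :
    σ (X * anchor ξ) = -σ X * anchor ξ := by
  rw [map_mul, hσ, mul_neg _ (anchor ξ), neg_mul _ (anchor ξ)]

lemma mul_anchor_inj {X Y : Hat ξ} : X * anchor ξ = Y * anchor ξ ↔ X = Y :=
  IsUnit.mul_left_inj ⟨⟨anchor ξ, anchor ξ, anchor_mul_self, anchor_mul_self⟩, rfl⟩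

lemma mulAnchor_evenPart {σ : Hat ξ ≃⋆ₐ[ℂ] Hat ξ} (hσ : σ (anchor ξ) = -anchor ξ) :
    mulAnchor (evenPart σ Set.univ) = oddPart σ Set.univ := by
  ext X
  rw [mem_mulAnchor]
  refine and_congr_right fun _ => ?_
  rw [map_mul_anchor hσ, mul_anchor_inj]
  exact neg_eq_iff_eq_neg

lemma isDirectSum_univ_Hat1_mulAnchor : IsDirectSum Set.univ (Hat1 ξ) (mulAnchor (Hat1 ξ)) := by
  rw [Hat1_eq_evenPart, mulAnchor_evenPart twistedTheta_anchor]
  exact isDirectSum_evenPart_oddPart isUnitalCStarSubalgebra_univ.isClosedStarSubspace.2.1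
    twistedTheta_twistedTheta (Set.mapsTo_univ _ _)

lemma oddPart_hatTheta_Hat1 :
    oddPart (hatTheta ξ) (Hat1 ξ) = mulAnchor (oddPart (hatTheta ξ) (Hat0 ξ)) := by
  ext X
  have hdual : dualAction ξ (X * anchor ξ) = X * anchor ξ ↔ -dualAction ξ X = X := by
    rw [map_mul_anchor dualAction_anchor, mul_anchor_inj]
  have hodd : hatTheta ξ (X * anchor ξ) = -(X * anchor ξ) ↔ hatTheta ξ X = -X := by
    rw [map_mul, hatTheta_anchor, ← neg_mul X, mul_anchor_inj]
  rw [mem_mulAnchor, Hat1_eq_evenPart, Hat0_eq_evenPart]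
  change (True ∧ twistedTheta ξ X = X) ∧ hatTheta ξ X = -X
    ↔ (True ∧ dualAction ξ (X * anchor ξ) = X * anchor ξ)
      ∧ hatTheta ξ (X * anchor ξ) = -(X * anchor ξ)
  rw [hdual, hodd]
  refine and_congr_left fun hX => and_congr_right fun _ => ?_
  rw [twistedTheta_apply, hX, map_neg (dualAction ξ)]

lemma isUnitalCStarSubalgebra_Hat0 : IsUnitalCStarSubalgebra (Hat0 ξ) := by
  rw [Hat0_eq_evenPart]
  exact isUnitalCStarSubalgebra_univ.evenPart continuous_dualAction

lemma isUnitalCStarSubalgebra_Hat1 : IsUnitalCStarSubalgebra (Hat1 ξ) := by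
  rw [Hat1_eq_evenPart]
  exact isUnitalCStarSubalgebra_univ.evenPart continuous_twistedTheta

lemma mapsTo_hatTheta_Hat0 : Set.MapsTo (hatTheta ξ) (Hat0 ξ) (Hat0 ξ) := by
  rw [Hat0_eq_evenPart]
  exact mapsTo_evenPart_of_comm dualAction_hatTheta_comm

lemma mapsTo_hatTheta_Hat1 : Set.MapsTo (hatTheta ξ) (Hat1 ξ) (Hat1 ξ) := by
  rw [Hat1_eq_evenPart]
  exact mapsTo_evenPart_of_comm fun X => dualAction_hatTheta_comm (hatTheta ξ X)

end ArakiJW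

end

theorem mainTheorem3 {𝔄 : ℤ → Type*} [∀ x, CStarAlgebra (𝔄 x)]
    (ξ : ∀ x, 𝔄 x ≃⋆ₐ[ℂ] Matrix (Fin 2) (Fin 2) ℂ) :
    (∃! θ : Hat ξ ≃⋆ₐ[ℂ] Hat ξ,
      (∀ A, θ (psi ξ A) = psi ξ (Theta ξ A)) ∧ θ (anchor ξ) = anchor ξ) ∧
    ∀ θ : Hat ξ ≃⋆ₐ[ℂ] Hat ξ,
      (∀ A, θ (psi ξ A) = psi ξ (Theta ξ A)) → θ (anchor ξ) = anchor ξ →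
        (θ '' Hat0 ξ ⊆ Hat0 ξ ∧ θ '' Hat1 ξ ⊆ Hat1 ξ) ∧
        (IsUnitalCStarSubalgebra (evenPart θ Set.univ) ∧
          IsUnitalCStarSubalgebra (evenPart θ (Hat0 ξ)) ∧
          IsUnitalCStarSubalgebra (evenPart θ (Hat1 ξ))) ∧
        (IsClosedStarSubspace (oddPart θ Set.univ) ∧
          IsClosedStarSubspace (oddPart θ (Hat0 ξ)) ∧
          IsClosedStarSubspace (oddPart θ (Hat1 ξ))) ∧
        (IsDirectSum Set.univ (evenPart θ Set.univ) (oddPart θ Set.univ) ∧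
          IsDirectSum (Hat0 ξ) (evenPart θ (Hat0 ξ)) (oddPart θ (Hat0 ξ)) ∧
          IsDirectSum (Hat1 ξ) (evenPart θ (Hat1 ξ)) (oddPart θ (Hat1 ξ))) ∧
        evenPart θ (Hat1 ξ) = evenPart θ (Hat0 ξ) ∧
        oddPart θ (Hat1 ξ) = mulAnchor (oddPart θ (Hat0 ξ)) ∧
        IsDirectSum Set.univ (Hat1 ξ) (mulAnchor (Hat1 ξ)) := by
  refine ⟨⟨hatTheta ξ, ⟨hatTheta_psi, hatTheta_anchor⟩, fun θ h => eq_hatTheta h.1 h.2⟩, ?_⟩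
  intro θ hpsi hanchor
  obtain rfl := eq_hatTheta hpsi hanchor
  have hcont := continuous_hatTheta (ξ := ξ)
  have halg := isUnitalCStarSubalgebra_univ (ξ := ξ)
  have halg0 := isUnitalCStarSubalgebra_Hat0 (ξ := ξ)
  have halg1 := isUnitalCStarSubalgebra_Hat1 (ξ := ξ)
  have hspace := halg.isClosedStarSubspace
  have hspace0 := halg0.isClosedStarSubspace
  have hspace1 := halg1.isClosedStarSubspace
  exact ⟨⟨mapsTo_hatTheta_Hat0.image_subset, mapsTo_hatTheta_Hat1.image_subset⟩,
    ⟨halg.evenPart hcont, halg0.evenPart hcont, halg1.evenPart hcont⟩,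
    ⟨hspace.oddPart hcont, hspace0.oddPart hcont, hspace1.oddPart hcont⟩,
    ⟨isDirectSum_evenPart_oddPart hspace.2.1 hatTheta_hatTheta (Set.mapsTo_univ _ _),
      isDirectSum_evenPart_oddPart hspace0.2.1 hatTheta_hatTheta mapsTo_hatTheta_Hat0,
      isDirectSum_evenPart_oddPart hspace1.2.1 hatTheta_hatTheta mapsTo_hatTheta_Hat1⟩,
    evenPart_hatTheta_Hat1, oddPart_hatTheta_Hat1, isDirectSum_univ_Hat1_mulAnchor⟩
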